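/- **Setting.** Let $\mathcal G=(\mathcal V,\mathcal E)$ be a connected, undirected graph on $\mathcal V=\{1,\dots,N\}$, $N\ge 2$, with Laplacian $\mathsf L$ and neighbor sets $\mathcal N_p$. Let $\mathsf V\in\mathbb R^{N\times(N-1)}$ have columns that, together with $1_N/\sqrt N$, form an orthonormal basis of $\mathbb R^N$ of eigenvectors of $\mathsf L$, and let $\mathsf D$ be the diagonal matrix of the corresponding eigenvalues, so $\mathsf L\mathsf V=\mathsf V\mathsf D$. For each agent $p$ let $0\le\delta_p<a_p$, $b_p>\delta_p$, $0<T_1^p\le T_2^p$; let $a^\star>0$ and $k_u,k_a,k_\theta>0$. Put $b_{\min}=\min_p(b_p-\delta_p)$, $b_{\max}=\max_p(b_p+\delta_p)$, $T_{\min}=\min_pT_1^p$, $T_2=(T_2^p)_p$, $\mathcal T=\prod_p[0,T_2^p]$. The state is $\xi=(z,\tau)$, $z=(\eta,\tilde\vartheta,\tilde a,\tilde\theta)\in\mathbb R^{N-1}\times\mathbb R^N\times\mathbb R^N\times\mathbb R^N$, $\tau\in\mathbb R^N$, where $\eta=\mathsf V^\top\vartheta$ for the software clocks $\vartheta\in\mathbb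 R^N$, $\tilde\vartheta=\vartheta-\hat\vartheta$, $\tilde a=a-\hat a$, $\tilde\theta=\theta-\hat\theta$. The closed-loop hybrid system $\mathcal H=(C,F,D,G)$ has flow set $C=\{\xi:\tau\in\mathcal T\}$, flow map $$F(\xi)=(\mathsf Fz+P_z)\times\{(-b_p+e_p)_p:|e_p|\le\delta_p\},\qquad P_z=\{(\mathsf V^\top d,d,0_N,d):|d_p|\le\delta_p\ \forall p\},$$ $$\mathsf F=\begin{bmatrix}-k_u\mathsf D&k_u\mathsf D\mathsf V^\top&\mathsf V^\top&0\\-k_u\mathsf V\mathsf D&k_u\mathsf L&I&0\\0&0&0&-k_aI\\0&0&I&-k_\theta I\end{bmatrix},$$ jump set $D=\bigcup_pD_p$, $D_p=\{\xi\in C:\tau_p=0\}$, and jump map $G(\xi)=\bigcup_{p:\,\xi\in D_p}G_p(\xi)$, where $G_p(\xi)$ consists of the points obtained from $\xi$ by setting $\tilde\vartheta_p$ to $0$ and $\tau_p$ to any value in $[T_1^p,T_2^p]$. Solutions, maximal solutions and completeness are those of the standard framework of Goebel, Sanfelice and Teel. The attractor is $\mathcal A=\{\xi\in C: z=0\}$,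 and $|\cdot|_{\mathcal A}$ is the Euclidean distance to it. A closed set $\mathcal A\subset C\cup D$ is *globally practically exponentially stable* (GPES) if every maximal solution $\phi$ is complete and has constants $\alpha,\kappa_1,\kappa_2>0$ with $|\phi(t,j)|_{\mathcal A}\le\kappa_1e^{-\alpha(t+j)}+\kappa_2$ on $\operatorname{dom}\phi$. Along a solution $\phi$, $\phi_\vartheta$ denotes any software clock trajectory with $\mathsf V^\top\phi_\vartheta=\phi_\eta$ on $\operatorname{dom}\phi$. $\mathcal H$ *achieves $\nu$-approximate synchronization* if for every maximal solution there is $T\ge0$ with $|\phi_{\vartheta_p}(t,j)-\phi_{\vartheta_q}(t,j)|\le\nu$ for all $(p,q)\in\mathcal E$ and all $(t,j)\in\operatorname{dom}\phi$ with $t+j\ge T$. The control inputs are $u_p=a^\star-\hat a_p+k_u\sum_{q\in\mathcal N_p}(\hat\vartheta_q-\hat\vartheta_p)$. For $\sigma>0$, symmetric positive definite $P_1\in\mathbb R^{(N-1)\times(N-1)}$, $P_3\in\mathbb R^{2N\times2N}$, and $P_{2,p}>0$, let $P_2(\tau)=\operatorname{diag}(P_{2,p}e^{\sigma\tau_p})$,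 $P(\tau)=\operatorname{diag}(P_1,P_2(\tau),P_3)$, $Q(\tau)=-\sigma b_{\min}\operatorname{diag}(0,P_2(\tau),0)$, $\mathsf M(\tau)=\mathsf F^\top P(\tau)+P(\tau)\mathsf F+Q(\tau)$, $\mu=-\sup_{\tau\in\mathcal T}\lambda_{\max}(\mathsf M(\tau))$, $\alpha_1=\lambda_{\min}(P(0))$, $\alpha_2=\lambda_{\max}(P(T_2))$, $\delta_{\max}=\sup_{d\in P_z}\|d\|$. **Theorem.** Suppose that $\mathsf M(\tau)$ is negative definite for every $\tau\in\mathcal T$. Then $\mu>0$ and $\mathcal A$ is GPES for $\mathcal H$. Moreover, for all $\varepsilon\in(0,1)$, $\kappa\in(0,\mu/\|P(T_2)\|)$ and $h\in(0,T_{\min}/b_{\max}]$, put $$\bar\mu=\frac{\mu-\kappa\|P(T_2)\|}{\alpha_2},\quad \kappa_1=\sqrt{\frac{\alpha_2}{\alpha_1}e^{\bar\mu(1-\varepsilon)h}},\quad \kappa_2=\sqrt{\frac{\|P(T_2)\|}{\alpha_1\bar\mu\kappa}}\,\delta_{\max},\quad \alpha=\frac12\min\Big\{\bar\mu\varepsilon,\frac{\bar\mu(1-\varepsilon)h}{N}\Big\}.$$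 Then $\bar\mu,\kappa_1,\alpha>0$, $\kappa_2\ge0$, $\kappa_2>0$ if some $\delta_p>0$, and the following hold. 1. For every maximal solution $\phi$ of $\mathcal H$ and every $(t,j)\in\operatorname{dom}\phi$, $|\phi(t,j)|_{\mathcal A}\le\kappa_1e^{-\alpha(t+j)}|\phi(0,0)|_{\mathcal A}+\kappa_2$. 2. If $\nu/\sqrt2>\kappa_2$, then $\mathcal H$ achieves $\nu$-approximate synchronization; for every maximal solution $\phi$ with $\nu/\sqrt2<\kappa_1|\phi(0,0)|_{\mathcal A}+\kappa_2$ one can take $$T=\frac1\alpha\ln\left(\frac{\sqrt2\,\kappa_1|\phi(0,0)|_{\mathcal A}}{\nu-\sqrt2\,\kappa_2}\right)\ge0.$$ Finally, along every maximal solution $\phi$ the control inputs $\phi_{u_p}(t,j)$, $p\in\mathcal V$, are bounded on $\operatorname{dom}\phi$. -/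

import Mathlib

open Set Matrix MeasureTheory

noncomputable section

/-! ### Hybrid systems: time domains, arcs, solutions -/

/-- A hybrid system with data `(C, F, D, G)`: flow set, flow map, jump set, jump map. -/
structure HybridSystem (X : Type*) where
  C : Set X
  F : X → Set X
  D : Set X
  G : X → Set X

/-- A compact hybrid time domain: a finite union of the sets `[t j, t (j+1)] × {j}`, `j < J`, with
`0 = t 0 ≤ t 1 ≤ ... ≤ t J` (the values of `t` beyond `J` are irrelevant). -/
def IsCompactHybridTimeDomain (E : Set (ℝ × ℕ)) : Prop :=
  ∃ (J : ℕ) (t : ℕ → ℝ), t 0 = 0 ∧ Monotone t ∧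
    E = {x | x.2 < J ∧ x.1 ∈ Icc (t x.2) (t (x.2 + 1))}

/-- A hybrid time domain: a subset of `ℝ≥0 × ℕ` each of whose truncations
`E ∩ ([0, T] × {0, ..., J})`, `(T, J) ∈ E`, is a compact hybrid time domain. -/
def IsHybridTimeDomain (E : Set (ℝ × ℕ)) : Prop :=
  (∀ x ∈ E, 0 ≤ x.1) ∧
    ∀ x ∈ E, IsCompactHybridTimeDomain (E ∩ {y | y.1 ≤ x.1 ∧ y.2 ≤ x.2})

/-- A function on hybrid time, with its domain; the values outside `dom` are irrelevant. -/
structure HybridSignal (X : Type*) where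
  dom : Set (ℝ × ℕ)
  val : ℝ → ℕ → X

namespace HybridSignal

variable {X : Type*}

/-- `I^j = {t : (t, j) ∈ dom φ}`. -/
def flowTimes (φ : HybridSignal X) (j : ℕ) : Set ℝ := {t | (t, j) ∈ φ.dom}

/-- A hybrid arc: the domain is a (nonempty) hybrid time domain, and `t ↦ φ (t, j)` is locally
absolutely continuous on `I^j` for every `j`. -/
structure IsHybridArc [PseudoMetricSpace X] (φ : HybridSignal X) : Prop where
  zero_mem : ((0 : ℝ), (0 : ℕ)) ∈ φ.dom
  isDomain : IsHybridTimeDomain φ.dom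
  absCont : ∀ (j : ℕ) (s t : ℝ), s ≤ t → Icc s t ⊆ φ.flowTimes j →
    AbsolutelyContinuousOnInterval (fun r => φ.val r j) s t

variable [NormedAddCommGroup X] [NormedSpace ℝ X]

/-- A solution of the hybrid system `H`. -/
structure IsSolution (H : HybridSystem X) (φ : HybridSignal X) : Prop where
  isArc : φ.IsHybridArc
  init : φ.val 0 0 ∈ closure H.C ∪ H.D
  flow_mem : ∀ j, ∀ t ∈ interior (φ.flowTimes j), φ.val t j ∈ H.C
  flow : ∀ j, ∀ᵐ t : ℝ, t ∈ interior (φ.flowTimes j) →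
    ∃ v ∈ H.F (φ.val t j), HasDerivAt (fun r => φ.val r j) v t
  jump : ∀ t j, (t, j) ∈ φ.dom → (t, j + 1) ∈ φ.dom →
    φ.val t j ∈ H.D ∧ φ.val t (j + 1) ∈ H.G (φ.val t j)

/-- A maximal solution: one that no solution properly extends. -/
def IsMaximalSolution (H : HybridSystem X) (φ : HybridSignal X) : Prop :=
  IsSolution H φ ∧ ∀ ψ : HybridSignal X, IsSolution H ψ → φ.dom ⊆ ψ.dom →
    (∀ t j, (t, j) ∈ φ.dom → ψ.val t j = φ.val t j) → ψ.dom ⊆ φ.dom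

/-- Completeness: the domain is unbounded. -/
def IsComplete (φ : HybridSignal X) : Prop :=
  ∀ B : ℝ, ∃ x ∈ φ.dom, B < x.1 + x.2

end HybridSignal

open HybridSignal in
/-- The set `A` is globally practically exponentially stable for `H`. -/
def IsGPES {X : Type*} [NormedAddCommGroup X] [NormedSpace ℝ X] (H : HybridSystem X)
    (A : Set X) : Prop :=
  IsClosed A ∧ A ⊆ H.C ∪ H.D ∧
    ∀ φ : HybridSignal X, IsMaximalSolution H φ → φ.IsComplete ∧
      ∃ α κ₁ κ₂ : ℝ, 0 < α ∧ 0 < κ₁ ∧ 0 < κ₂ ∧ ∀ t j, (t, j) ∈ φ.dom →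
        Metric.infDist (φ.val t j) A ≤ κ₁ * Real.exp (-α * (t + j)) + κ₂

namespace ChronoSync

/-! ### The multi-agent system -/

/-- The agents, their coupling graph and all parameters of the protocol. -/
structure Network (N : ℕ) where
  /-- coupling graph -/
  graph : SimpleGraph (Fin N)
  connected : graph.Connected
  /-- hardware clock drifts -/
  a : Fin N → ℝ
  /-- disturbance bounds -/
  δ : Fin N → ℝ
  δ_nonneg : ∀ p, 0 ≤ δ p
  δ_lt_a : ∀ p, δ p < a p
  /-- timer drifts -/
  b : Fin N → ℝ
  δ_lt_b : ∀ p, δ p < b p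
  /-- timer reset bounds -/
  T₁ : Fin N → ℝ
  T₂ : Fin N → ℝ
  T₁_pos : ∀ p, 0 < T₁ p
  T₁_le_T₂ : ∀ p, T₁ p ≤ T₂ p
  /-- desired drift -/
  aStar : ℝ
  aStar_pos : 0 < aStar
  /-- controller gain and estimator gains -/
  ku : ℝ
  ka : ℝ
  kθ : ℝ
  ku_pos : 0 < ku
  ka_pos : 0 < ka
  kθ_pos : 0 < kθ

variable {N : ℕ}

open scoped Classical in
/-- The graph Laplacian. -/
def laplacian (S : Network N) : Matrix (Fin N) (Fin N) ℝ := S.graph.lapMatrix ℝ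

/-- The columns of `V` together with the normalized all-ones vector form an orthonormal basis of
`ℝ^N` consisting of eigenvectors of the Laplacian, and `D` is the diagonal matrix of the
eigenvalues belonging to the columns of `V`. -/
structure IsLaplacianEigenbasis (S : Network N) (V : Matrix (Fin N) (Fin (N - 1)) ℝ)
    (D : Matrix (Fin (N - 1)) (Fin (N - 1)) ℝ) : Prop where
  orthonormal : Vᵀ * V = 1
  orthogonal_ones : Vᵀ *ᵥ (fun _ => 1) = 0
  isDiag : D.IsDiag
  eigen : laplacian S * V = V * D

/-- Index set of `z = (η, ϑ̃, ã, θ̃) ∈ ℝ^(N-1) × ℝ^N × ℝ^N × ℝ^N`. -/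
abbrev ZIdx (N : ℕ) : Type := Fin (N - 1) ⊕ (Fin N ⊕ (Fin N ⊕ Fin N))

/-- The state space of `ξ = (z, τ)`, with the Euclidean norm. -/
abbrev State (N : ℕ) : Type := EuclideanSpace ℝ (ZIdx N ⊕ Fin N)

/-- Build `z` from its components. -/
def mkZ (η : Fin (N - 1) → ℝ) (ϑt at' θt : Fin N → ℝ) : EuclideanSpace ℝ (ZIdx N) :=
  WithLp.toLp 2 (Sum.elim η (Sum.elim ϑt (Sum.elim at' θt)))

/-- The component `z` of the state. -/
def zPart (ξ : State N) : EuclideanSpace ℝ (ZIdx N) := WithLp.toLp 2 fun i => ξ (Sum.inl i)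

/-- The component `η` (disagreement of the software clocks). -/
def eta (ξ : State N) : Fin (N - 1) → ℝ := fun i => ξ (Sum.inl (Sum.inl i))

/-- The component `ϑ̃ = ϑ - ϑ̂`. -/
def vtilde (ξ : State N) : Fin N → ℝ := fun p => ξ (Sum.inl (Sum.inr (Sum.inl p)))

/-- The component `ã = a - â`. -/
def atilde (ξ : State N) : Fin N → ℝ := fun p => ξ (Sum.inl (Sum.inr (Sum.inr (Sum.inl p))))

/-- The component `θ̃ = θ - θ̂`. -/
def thtilde (ξ : State N) : Fin N → ℝ := fun p => ξ (Sum.inl (Sum.inr (Sum.inr (Sum.inr p))))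

/-- The timers. -/
def tau (ξ : State N) : Fin N → ℝ := fun p => ξ (Sum.inr p)

/-! ### The closed-loop hybrid system -/

/-- The box `[0, T₂¹] × ... × [0, T₂ᴺ]` of timer values. -/
def timerBox (S : Network N) : Set (Fin N → ℝ) := {τ | ∀ p, τ p ∈ Icc 0 (S.T₂ p)}

/-- The disturbances `(d_p)` with `|d_p| ≤ δ_p`. -/
def disturbances (S : Network N) : Set (Fin N → ℝ) := {d | ∀ p, d p ∈ Icc (-S.δ p) (S.δ p)}

/-- The perturbation set of `z`: all `(Vᵀ d, d, 0, d)` with `|d_p| ≤ δ_p`. -/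
def Pz (S : Network N) (V : Matrix (Fin N) (Fin (N - 1)) ℝ) : Set (EuclideanSpace ℝ (ZIdx N)) :=
  {w | ∃ d ∈ disturbances S, w = mkZ (Vᵀ *ᵥ d) d 0 d}

/-- The matrix of the flow of `z`; its rows of blocks are
`(-k_u D, k_u D Vᵀ, Vᵀ, 0)`, `(-k_u V D, k_u L, I, 0)`, `(0, 0, 0, -k_a I)`,
`(0, 0, I, -k_θ I)`. -/
def flowMatrix (S : Network N) (V : Matrix (Fin N) (Fin (N - 1)) ℝ)
    (D : Matrix (Fin (N - 1)) (Fin (N - 1)) ℝ) : Matrix (ZIdx N) (ZIdx N) ℝ :=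
  fromBlocks
    (-S.ku • D)
    (fromCols (S.ku • (D * Vᵀ)) (fromCols Vᵀ 0))
    (fromRows (-S.ku • (V * D)) 0)
    (fromBlocks
      (S.ku • laplacian S) (fromCols 1 0)
      0 (fromBlocks 0 (-S.ka • 1) 1 (-S.kθ • 1)))

/-- The flow set: all timers lie in their ranges. -/
def flowSet (S : Network N) : Set (State N) := {ξ | tau ξ ∈ timerBox S}

/-- The flow map `F(ξ) = (F z + P_z) × (-b + P_τ)`. -/
def flowMap (S : Network N) (V : Matrix (Fin N) (Fin (N - 1)) ℝ)
    (D : Matrix (Fin (N - 1)) (Fin (N - 1)) ℝ) (ξ : State N) : Set (State N) :=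
  {v | (∃ w ∈ Pz S V, zPart v = WithLp.toLp 2 (flowMatrix S V D *ᵥ (zPart ξ).ofLp) + w) ∧
    ∃ d ∈ disturbances S, tau v = -S.b + d}

/-- Jumps triggered by agent `p`: all timers are in their ranges, and that of `p` is zero. -/
def jumpSetOf (S : Network N) (p : Fin N) : Set (State N) := {ξ ∈ flowSet S | tau ξ p = 0}

/-- The jump set. -/
def jumpSet (S : Network N) : Set (State N) := ⋃ p, jumpSetOf S p

/-- The jumps of agent `p`: the `p`-th component of `ϑ̃` is reset to zero, the timer `τ_p` to any
value in `[T₁ p, T₂ p]`, and everything else is kept. -/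
def jumpMapOf (S : Network N) (p : Fin N) (ξ : State N) : Set (State N) :=
  {g | eta g = eta ξ ∧ vtilde g = Function.update (vtilde ξ) p 0 ∧ atilde g = atilde ξ ∧
    thtilde g = thtilde ξ ∧ tau g p ∈ Icc (S.T₁ p) (S.T₂ p) ∧ ∀ q, q ≠ p → tau g q = tau ξ q}

/-- The jump map. -/
def jumpMap (S : Network N) (ξ : State N) : Set (State N) :=
  {g | ∃ p, ξ ∈ jumpSetOf S p ∧ g ∈ jumpMapOf S p ξ}

/-- The closed-loop hybrid system. -/
def closedLoop (S : Network N) (V : Matrix (Fin N) (Fin (N - 1)) ℝ)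
    (D : Matrix (Fin (N - 1)) (Fin (N - 1)) ℝ) : HybridSystem (State N) where
  C := flowSet S
  F := flowMap S V D
  D := jumpSet S
  G := jumpMap S

/-- The attractor. -/
def attractor (S : Network N) : Set (State N) := {ξ ∈ flowSet S | ‖zPart ξ‖ = 0}

/-! ### Software clocks, approximate synchronization and control inputs -/

/-- `ϑ` is a trajectory of software clock values that underlies `φ`, that is, `η = Vᵀ ϑ`
along `φ`. -/
def IsSoftwareClock (V : Matrix (Fin N) (Fin (N - 1)) ℝ) (φ : HybridSignal (State N))
    (ϑ : ℝ → ℕ → Fin N → ℝ) : Prop :=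
  ∀ t j, (t, j) ∈ φ.dom → eta (φ.val t j) = Vᵀ *ᵥ ϑ t j

/-- From the hybrid time `t + j ≥ T` on, the software clocks of neighbours differ by at most
`ν`. -/
def SyncFrom (S : Network N) (V : Matrix (Fin N) (Fin (N - 1)) ℝ) (φ : HybridSignal (State N))
    (ν T : ℝ) : Prop :=
  ∀ ϑ, IsSoftwareClock V φ ϑ → ∀ t j, (t, j) ∈ φ.dom → T ≤ t + j →
    ∀ p q, S.graph.Adj p q → |ϑ t j p - ϑ t j q| ≤ ν

/-- `ν`-approximate synchronization of the closed-loop system. -/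
def AchievesApproxSync (S : Network N) (V : Matrix (Fin N) (Fin (N - 1)) ℝ)
    (D : Matrix (Fin (N - 1)) (Fin (N - 1)) ℝ) (ν : ℝ) : Prop :=
  ∀ φ, HybridSignal.IsMaximalSolution (closedLoop S V D) φ → ∃ T : ℝ, 0 ≤ T ∧ SyncFrom S V φ ν T

open scoped Classical in
/-- The control input `u_p = a* - â_p + k_u ∑_{q ∈ N_p} (ϑ̂_q - ϑ̂_p)` at the state `ξ` when the
software clocks show `ϑ`; here `â = a - ã` and `ϑ̂ = ϑ - ϑ̃`. -/
def controlInput (S : Network N) (ξ : State N) (ϑ : Fin N → ℝ) (p : Fin N) : ℝ :=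
  S.aStar - (S.a p - atilde ξ p) +
    S.ku * ∑ q ∈ S.graph.neighborFinset p, ((ϑ q - vtilde ξ q) - (ϑ p - vtilde ξ p))

/-! ### Lyapunov matrices and the constants of the bound -/

/-- The constant `σ > 0`, the positive definite matrices `P₁`, `P₃` and the positive numbers
`P_{2,p}`. -/
structure LyapunovData (N : ℕ) where
  σ : ℝ
  σ_pos : 0 < σ
  P₁ : Matrix (Fin (N - 1)) (Fin (N - 1)) ℝ
  P₁_posDef : P₁.PosDef
  p₂ : Fin N → ℝ
  p₂_pos : ∀ p, 0 < p₂ p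
  P₃ : Matrix (Fin N ⊕ Fin N) (Fin N ⊕ Fin N) ℝ
  P₃_posDef : P₃.PosDef

/-- `P₂(τ) = diag(P_{2,p} exp(σ τ_p))`. -/
def P2 (Λ : LyapunovData N) (τ : Fin N → ℝ) : Matrix (Fin N) (Fin N) ℝ :=
  diagonal fun p => Λ.p₂ p * Real.exp (Λ.σ * τ p)

/-- `P(τ) = diag(P₁, P₂(τ), P₃)`. -/
def PMat (Λ : LyapunovData N) (τ : Fin N → ℝ) : Matrix (ZIdx N) (ZIdx N) ℝ :=
  fromBlocks Λ.P₁ 0 0 (fromBlocks (P2 Λ τ) 0 0 Λ.P₃)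

/-- Least flow speed of the timers. -/
def bMin (S : Network N) : ℝ := ⨅ p, (S.b p - S.δ p)

/-- Greatest flow speed of the timers. -/
def bMax (S : Network N) : ℝ := ⨆ p, (S.b p + S.δ p)

/-- Least timer reset value. -/
def TMin (S : Network N) : ℝ := ⨅ p, S.T₁ p

/-- `Q(τ) = -σ b_min diag(0, P₂(τ), 0)`. -/
def QMat (S : Network N) (Λ : LyapunovData N) (τ : Fin N → ℝ) : Matrix (ZIdx N) (ZIdx N) ℝ :=
  (-(Λ.σ * bMin S)) • fromBlocks 0 0 0 (fromBlocks (P2 Λ τ) 0 0 0)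

/-- `M(τ) = Fᵀ P(τ) + P(τ) F + Q(τ)`. -/
def MMat (S : Network N) (V : Matrix (Fin N) (Fin (N - 1)) ℝ)
    (D : Matrix (Fin (N - 1)) (Fin (N - 1)) ℝ) (Λ : LyapunovData N) (τ : Fin N → ℝ) :
    Matrix (ZIdx N) (ZIdx N) ℝ :=
  (flowMatrix S V D)ᵀ * PMat Λ τ + PMat Λ τ * flowMatrix S V D + QMat S Λ τ

/-- Greatest eigenvalue of a real symmetric matrix. -/
def lamMax {n : Type*} [Fintype n] [DecidableEq n] (A : Matrix n n ℝ) : ℝ := sSup (spectrum ℝ A)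

/-- Least eigenvalue of a real symmetric matrix. -/
def lamMin {n : Type*} [Fintype n] [DecidableEq n] (A : Matrix n n ℝ) : ℝ := sInf (spectrum ℝ A)

/-- The spectral norm of a matrix. -/
def specNorm {n : Type*} [Fintype n] [DecidableEq n] (A : Matrix n n ℝ) : ℝ :=
  ‖Matrix.toEuclideanCLM (𝕜 := ℝ) A‖

/-- `μ = -sup {λ_max(M(τ)) : τ in the timer box}`. -/
def mu (S : Network N) (V : Matrix (Fin N) (Fin (N - 1)) ℝ)
    (D : Matrix (Fin (N - 1)) (Fin (N - 1)) ℝ) (Λ : LyapunovData N) : ℝ :=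
  -sSup ((fun τ => lamMax (MMat S V D Λ τ)) '' timerBox S)

/-- `α₁ = λ_min(P(0))`. -/
def alpha1 (Λ : LyapunovData N) : ℝ := lamMin (PMat Λ 0)

/-- `α₂ = λ_max(P(T₂))`. -/
def alpha2 (S : Network N) (Λ : LyapunovData N) : ℝ := lamMax (PMat Λ S.T₂)

/-- `δ_max = sup {‖d‖ : d ∈ P_z}`. -/
def deltaMax (S : Network N) (V : Matrix (Fin N) (Fin (N - 1)) ℝ) : ℝ :=
  sSup ((fun w => ‖w‖) '' Pz S V)

/-- `μ̄ = (μ - κ ‖P(T₂)‖) / α₂`. -/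
def muBar (S : Network N) (V : Matrix (Fin N) (Fin (N - 1)) ℝ)
    (D : Matrix (Fin (N - 1)) (Fin (N - 1)) ℝ) (Λ : LyapunovData N) (κ : ℝ) : ℝ :=
  (mu S V D Λ - κ * specNorm (PMat Λ S.T₂)) / alpha2 S Λ

/-- `κ₁ = √((α₂ / α₁) exp(μ̄ (1 - ε) h))`. -/
def kappa1 (S : Network N) (V : Matrix (Fin N) (Fin (N - 1)) ℝ)
    (D : Matrix (Fin (N - 1)) (Fin (N - 1)) ℝ) (Λ : LyapunovData N) (κ ε h : ℝ) : ℝ :=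
  √(alpha2 S Λ / alpha1 Λ * Real.exp (muBar S V D Λ κ * (1 - ε) * h))

/-- `κ₂ = √(‖P(T₂)‖ / (α₁ μ̄ κ)) δ_max`. -/
def kappa2 (S : Network N) (V : Matrix (Fin N) (Fin (N - 1)) ℝ)
    (D : Matrix (Fin (N - 1)) (Fin (N - 1)) ℝ) (Λ : LyapunovData N) (κ : ℝ) : ℝ :=
  √(specNorm (PMat Λ S.T₂) / (alpha1 Λ * muBar S V D Λ κ * κ)) * deltaMax S V

/-- `α = ½ min {μ̄ ε, μ̄ (1 - ε) h / N}`. -/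
def rate (S : Network N) (V : Matrix (Fin N) (Fin (N - 1)) ℝ)
    (D : Matrix (Fin (N - 1)) (Fin (N - 1)) ℝ) (Λ : LyapunovData N) (κ ε h : ℝ) : ℝ :=
  1 / 2 * min (muBar S V D Λ κ * ε) (muBar S V D Λ κ * (1 - ε) * h / N)

/-- `T = (1 / α) ln (√2 κ₁ r / (ν - √2 κ₂))`, where `r` is the initial distance to the
attractor. -/
def syncTime (S : Network N) (V : Matrix (Fin N) (Fin (N - 1)) ℝ)
    (D : Matrix (Fin (N - 1)) (Fin (N - 1)) ℝ) (Λ : LyapunovData N) (κ ε h ν r : ℝ) : ℝ :=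
  1 / rate S V D Λ κ ε h *
    Real.log (√2 * kappa1 S V D Λ κ ε h * r / (ν - √2 * kappa2 S V D Λ κ))

end ChronoSync

end

open ChronoSync

/-!
The proof is a Lyapunov argument with `lyap ξ = zᵀ P(τ) z`, which is squeezed between
`α₁ ‖z‖²` and `α₂ ‖z‖²` on the flow set, where `‖z‖` is the distance to the attractor.

Along flows the timers decrease at least at rate `b_min`, so the derivative of the weights
`exp (σ τ_p)` contributes at most `zᵀ Q(τ) z`. The derivative of `lyap` is thus at most
`zᵀ M(τ) z + 2 zᵀ P(τ) w` with a perturbation `w ∈ P_z`. By compactness of the timer box `M(τ)` is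
uniformly negative definite, which gives `μ > 0`, and Young's inequality absorbs the mixed term
(`lyap_deriv_le`). A jump only deletes the nonnegative summand of `ϑ̃_p` (`lyap_jump_le`). Hence
`lyap` decays exponentially in ordinary time up to an offset (`lyap_le_exp`).

Decay in ordinary time is decay in hybrid time because jumps are rare (`jumps_le`): the potential
`∑ min (τ_p / T₁ p) 1` lies in `[0, N]`, rises by one at each jump and falls at a bounded rate.
Together these give the bound `norm_zPart_le_exp`.

Maximal solutions are complete (`HybridSignal.IsMaximalSolution.isComplete`): on a bounded domain
the velocities are bounded, so the solution has a limit at the end of its last flow interval, and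
from there it can flow on or jump. A literal hybrid time domain may branch, that is, flow on past
the time of a jump; solutions do not, because an expired timer would become negative
(`flow_ends_of_mem_jumpSet`).

Synchronization follows from `V Vᵀ = 1 - 1 1ᵀ / N`, which bounds differences of software clocks by
`√2 ‖η‖`.
-/

/-! ### Absolutely continuous functions -/

namespace AbsolutelyContinuousOnInterval

variable {E F : Type*} [NormedAddCommGroup E] [NormedAddCommGroup F] {a b : ℝ}

/-- Absolute continuity survives composition with a function that is Lipschitz on the range. -/
theorem comp_lipschitzOnWith {f : ℝ → E} {g : E → F} {K : NNReal}
    (hf : AbsolutelyContinuousOnInterval f a b) (hg : LipschitzOnWith K g (f '' uIcc a b)) :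
    AbsolutelyContinuousOnInterval (fun t => g (f t)) a b := by
  rw [absolutelyContinuousOnInterval_iff] at hf ⊢
  intro ε hε
  obtain ⟨δ, hδ, h⟩ := hf (ε / (K + 1)) (by positivity)
  refine ⟨δ, hδ, fun P hP hP' => ?_⟩
  have h1 := h P hP hP'
  have h2 : ∑ i ∈ Finset.range P.1, dist (g (f (P.2 i).1)) (g (f (P.2 i).2)) ≤
      K * ∑ i ∈ Finset.range P.1, dist (f (P.2 i).1) (f (P.2 i).2) := by
    rw [Finset.mul_sum]
    refine Finset.sum_le_sum fun i hi => hg.dist_le_mul _ ?_ _ ?_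
    · exact mem_image_of_mem _ (hP.1 i hi).1
    · exact mem_image_of_mem _ (hP.1 i hi).2
  have h3 : 0 ≤ ∑ i ∈ Finset.range P.1, dist (f (P.2 i).1) (f (P.2 i).2) :=
    Finset.sum_nonneg fun _ _ => dist_nonneg
  rw [lt_div_iff₀ (by positivity)] at h1
  nlinarith

theorem comp_contDiff [NormedSpace ℝ E] [NormedSpace ℝ F] [FiniteDimensional ℝ E] {f : ℝ → E}
    {g : E → F} (hf : AbsolutelyContinuousOnInterval f a b) (hg : ContDiff ℝ 1 g) :
    AbsolutelyContinuousOnInterval (fun t => g (f t)) a b := by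
  obtain ⟨C, hC⟩ := hf.exists_bound
  have := FiniteDimensional.proper ℝ E
  obtain ⟨K, hK⟩ := hg.contDiffOn.exists_lipschitzOnWith one_ne_zero
    (convex_closedBall (0 : E) C) (isCompact_closedBall 0 C)
  refine hf.comp_lipschitzOnWith (hK.mono ?_)
  rintro _ ⟨t, ht, rfl⟩
  simpa using hC t ht

theorem le_of_ae_hasDerivAt_nonpos {f : ℝ → ℝ} (hab : a ≤ b)
    (hf : AbsolutelyContinuousOnInterval f a b)
    (h : ∀ᵐ x, x ∈ Ioo a b → ∃ f' ≤ 0, HasDerivAt f f' x) : f b ≤ f a := by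
  have h1 := hf.integral_deriv_eq_sub
  have h2 : ∫ x in a..b, deriv f x ≤ 0 := by
    rw [intervalIntegral.integral_of_le hab, integral_Ioc_eq_integral_Ioo]
    refine setIntegral_nonpos_ae measurableSet_Ioo ?_
    filter_upwards [h] with x hx hx'
    obtain ⟨f', hf', hd⟩ := hx hx'
    rwa [hd.deriv]
  linarith

theorem norm_sub_le_of_ae_hasDerivAt [NormedSpace ℝ E] [FiniteDimensional ℝ E] {f : ℝ → E} {K : ℝ}
    (hab : a ≤ b) (hf : AbsolutelyContinuousOnInterval f a b)
    (h : ∀ᵐ x, x ∈ Ioo a b → ∃ f', ‖f'‖ ≤ K ∧ HasDerivAt f f' x) :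
    ‖f b - f a‖ ≤ K * (b - a) := by
  -- reduce to a scalar function by testing with a norming functional
  obtain ⟨g, hg, hg'⟩ := exists_dual_vector'' ℝ (f b - f a)
  have h1 : AbsolutelyContinuousOnInterval (fun t => g (f t) - K * t) a b :=
    (hf.comp_contDiff g.contDiff).fun_sub
      (ContDiffOn.absolutelyContinuousOnInterval (by fun_prop))
  have h2 := h1.le_of_ae_hasDerivAt_nonpos hab (by
    filter_upwards [h] with x hx hx'
    obtain ⟨f', hf', hd⟩ := hx hx'
    refine ⟨g f' - K * 1, ?_, (g.hasFDerivAt.comp_hasDerivAt x hd).sub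
      ((hasDerivAt_id x).const_mul K)⟩
    have := (le_abs_self _).trans (g.le_opNorm f')
    nlinarith [norm_nonneg f'])
  rw [map_sub] at hg'
  simp only [RCLike.ofReal_real_eq_id, id] at hg'
  linarith

end AbsolutelyContinuousOnInterval

/-! ### Hybrid time domains -/

namespace IsHybridTimeDomain

variable {E : Set (ℝ × ℕ)}

/-- Induction along a hybrid time domain: a property that holds initially and is passed on by flows
and by jumps holds at every hybrid time. -/
theorem induction (hE : IsHybridTimeDomain E) {P : ℝ → ℕ → Prop} (h0 : P 0 0)
    (hflow : ∀ j s t, s ≤ t → (∀ r ∈ Icc s t, (r, j) ∈ E) → P s j → P t j)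
    (hjump : ∀ t j, (t, j) ∈ E → (t, j + 1) ∈ E → P t j → P t (j + 1)) {t : ℝ} {j : ℕ}
    (h : (t, j) ∈ E) : P t j := by
  obtain ⟨J, s, hs0, hs, hEs⟩ := hE.2 _ h
  have hmem : ∀ i r, i < J → r ∈ Icc (s i) (s (i + 1)) → (r, i) ∈ E := fun i r hi hr => by
    have : (r, i) ∈ {x : ℝ × ℕ | x.2 < J ∧ x.1 ∈ Icc (s x.2) (s (x.2 + 1))} := ⟨hi, hr⟩
    rw [← hEs] at this
    exact this.1
  have htj : (t, j) ∈ {x : ℝ × ℕ | x.2 < J ∧ x.1 ∈ Icc (s x.2) (s (x.2 + 1))} := by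
    rw [← hEs]; exact ⟨h, le_rfl, le_rfl⟩
  have hP : ∀ i ≤ j, P (s i) i := by
    intro i hi
    induction i with
    | zero => rwa [hs0]
    | succ i ih =>
      have hiJ : i + 1 < J := hi.trans_lt htj.1
      have h1 := hs (Nat.le_succ i)
      have h2 := hs (Nat.le_succ (i + 1))
      refine hjump _ _ (hmem i _ (by omega) ⟨h1, le_rfl⟩) (hmem (i + 1) _ hiJ ⟨le_rfl, h2⟩) ?_
      exact hflow _ _ _ h1 (fun r hr => hmem i r (by omega) hr) (ih (by omega))
  exact hflow _ _ _ htj.2.1 (fun r hr => hmem j r htj.1 ⟨hr.1, hr.2.trans htj.2.2⟩) (hP j le_rfl)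

theorem ordConnected (hE : IsHybridTimeDomain E) {s t r : ℝ} {j : ℕ} (hs : (s, j) ∈ E)
    (ht : (t, j) ∈ E) (hr : r ∈ Icc s t) : (r, j) ∈ E := by
  obtain ⟨J, u, hu0, hu, hEu⟩ := hE.2 _ ht
  have h1 : (s, j) ∈ {x : ℝ × ℕ | x.2 < J ∧ x.1 ∈ Icc (u x.2) (u (x.2 + 1))} := by
    rw [← hEu]; exact ⟨hs, hr.1.trans hr.2, le_rfl⟩
  have h2 : (t, j) ∈ {x : ℝ × ℕ | x.2 < J ∧ x.1 ∈ Icc (u x.2) (u (x.2 + 1))} := by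
    rw [← hEu]; exact ⟨ht, le_rfl, le_rfl⟩
  have h3 : (r, j) ∈ {x : ℝ × ℕ | x.2 < J ∧ x.1 ∈ Icc (u x.2) (u (x.2 + 1))} :=
    ⟨h1.1, h1.2.1.trans hr.1, hr.2.trans h2.2.2⟩
  rw [← hEu] at h3
  exact h3.1

/-- The truncation of a hybrid time domain at one of its points, described by jump times that stay
at the truncation time from the last jump on. -/
theorem exists_jumpTimes (hE : IsHybridTimeDomain E) {T : ℝ} {J : ℕ} (h : (T, J) ∈ E) :
    ∃ s : ℕ → ℝ, s 0 = 0 ∧ Monotone s ∧ (∀ k > J, s k = T) ∧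
      ∀ r k, k ≤ J → ((r, k) ∈ E ∧ r ≤ T ↔ r ∈ Icc (s k) (s (k + 1))) := by
  obtain ⟨K, u, hu0, hu, hEu⟩ := hE.2 _ h
  have hmem : ∀ r k, ((r, k) ∈ E ∧ r ≤ T ∧ k ≤ J) ↔ (k < K ∧ r ∈ Icc (u k) (u (k + 1))) :=
    fun r k => (Set.ext_iff.1 hEu (r, k))
  have hTJ := (hmem T J).1 ⟨h, le_rfl, le_rfl⟩
  have hle : ∀ k ≤ J, u k ≤ T := fun k hk => (hu hk).trans hTJ.2.1
  refine ⟨fun k => if k ≤ J then u k else T, by simp [hu0], ?_, fun k hk => ?_, fun r k hk => ?_⟩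
  · intro k l hkl
    dsimp only
    split_ifs with h1 h2 h2
    · exact hu hkl
    · exact hle k h1
    · omega
    · exact le_rfl
  · simp [hk]
  · have h1 := hmem r k
    simp only [hk, if_true, and_true] at h1 ⊢
    rw [h1]
    by_cases hkJ : k + 1 ≤ J
    · simp only [hkJ, if_true, and_iff_right_iff_imp]
      intro _; have := hTJ.1; omega
    · obtain rfl : k = J := by omega
      simp only [hkJ, if_false]
      constructor
      · rintro ⟨h2, h3⟩; exact ⟨h3.1, (h1.2 ⟨h2, h3⟩).2⟩
      · rintro h2; exact ⟨hTJ.1, h2.1, h2.2.trans hTJ.2.2⟩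

/-- If flows never continue beyond a jump time, later levels of a hybrid time domain carry later
times. -/
theorem le_of_lt_level (hE : IsHybridTimeDomain E)
    (hbr : ∀ t j, (t, j) ∈ E → (t, j + 1) ∈ E → ∀ s, (s, j) ∈ E → s ≤ t) {s t : ℝ} {i j : ℕ}
    (hs : (s, i) ∈ E) (ht : (t, j) ∈ E) (hij : i < j) : s ≤ t := by
  obtain ⟨u, hu0, hu, huT, hmem⟩ := hE.exists_jumpTimes ht
  have h1 := (hmem (u (i + 1)) i hij.le).2 ⟨hu (Nat.le_succ i), le_rfl⟩
  have h2 := (hmem (u (i + 1)) (i + 1) hij).2 ⟨le_rfl, hu (Nat.le_succ _)⟩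
  exact (hbr _ _ h1.1 h2.1 s hs).trans h1.2

/-- Hybrid time domains may be continued by a flow on the last level. -/
theorem extend_flow (hE : IsHybridTimeDomain E)
    (hbr : ∀ t j, (t, j) ∈ E → (t, j + 1) ∈ E → ∀ s, (s, j) ∈ E → s ≤ t) {J : ℕ} {T₀ T₁ : ℝ}
    (hJ : ∀ x ∈ E, x.2 ≤ J) (hT₀ : (T₀, J) ∈ E) :
    IsHybridTimeDomain (E ∪ {x | x.2 = J ∧ x.1 ∈ Icc T₀ T₁}) := by
  have h0 := hE.1 _ hT₀
  -- a truncation that does not involve the new points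
  have hold : ∀ x ∈ E, (x.2 < J ∨ x.1 < T₀) → IsCompactHybridTimeDomain
      ((E ∪ {x | x.2 = J ∧ x.1 ∈ Icc T₀ T₁}) ∩ {y | y.1 ≤ x.1 ∧ y.2 ≤ x.2}) := by
    intro x hx hx'
    convert hE.2 x hx using 1
    ext y
    simp only [mem_inter_iff, mem_union, mem_ofPred_eq, mem_Icc]
    constructor
    · rintro ⟨h1 | h1, h2⟩
      · exact ⟨h1, h2⟩
      · rcases hx' with h | h
        · omega
        · linarith [h1.2.1, h2.1]
    · rintro ⟨h1, h2⟩; exact ⟨Or.inl h1, h2⟩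
  have hnew : ∀ t, T₀ ≤ t → (∀ r ∈ Icc T₀ t, (r, J) ∈ E ∪ {x | x.2 = J ∧ x.1 ∈ Icc T₀ T₁}) →
      IsCompactHybridTimeDomain
      ((E ∪ {x | x.2 = J ∧ x.1 ∈ Icc T₀ T₁}) ∩ {y | y.1 ≤ t ∧ y.2 ≤ J}) := by
    intro t ht hall
    obtain ⟨u, hu0, hu, huT, hmem⟩ := hE.exists_jumpTimes hT₀
    have huJ : u J ≤ T₀ := by
      rw [← huT (J + 1) (by omega)]; exact hu (Nat.le_succ J)
    refine ⟨J + 1, fun k => if k ≤ J then u k else t, by simp [hu0], ?_, ?_⟩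
    · intro k l hkl
      dsimp only
      split_ifs with h1 h2 h2
      · exact hu hkl
      · exact ((hu h1).trans huJ).trans ht
      · omega
      · exact le_rfl
    · ext ⟨r, k⟩
      simp only [mem_inter_iff, mem_ofPred_eq]
      constructor
      · rintro ⟨h1, h2, h3⟩
        refine ⟨by omega, ?_⟩
        rcases Nat.lt_or_ge k J with hk | hk
        · have h1' : (r, k) ∈ E := by
            rcases h1 with h1 | h1
            · exact h1
            · exact absurd h1.1 hk.ne
          have := (hmem r k h3).1 ⟨h1', hE.le_of_lt_level hbr h1' hT₀ hk⟩
          simpa [h3, hk, Nat.succ_le_of_lt hk] using this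
        · obtain rfl : k = J := by omega
          simp only [le_refl, if_true, Nat.not_succ_le_self, if_false]
          refine ⟨?_, h2⟩
          rcases le_total r T₀ with hr | hr
          · rcases h1 with h1 | h1
            · exact ((hmem r k le_rfl).1 ⟨h1, hr⟩).1
            · exact huJ.trans h1.2.1
          · exact huJ.trans hr
      · rintro ⟨hk, hr⟩
        have hk' : k ≤ J := by omega
        rcases Nat.lt_or_ge k J with hk | hk
        · simp only [hk', if_true, Nat.succ_le_of_lt hk] at hr
          have := (hmem r k hk').2 hr
          exact ⟨Or.inl this.1, this.2.trans ht, hk'⟩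
        · obtain rfl : k = J := by omega
          simp only [le_refl, if_true, Nat.not_succ_le_self, if_false] at hr
          refine ⟨?_, hr.2, le_rfl⟩
          rcases le_total r T₀ with h | h
          · exact Or.inl ((hmem r k le_rfl).2 ⟨hr.1, by rwa [huT _ (by omega)]⟩).1
          · exact hall r ⟨h, hr.2⟩
  constructor
  · rintro x (hx | hx)
    · exact hE.1 x hx
    · exact h0.trans hx.2.1
  · rintro ⟨t, j⟩ (hx | ⟨rfl, hx⟩)
    · by_cases h : j < J ∨ t < T₀
      · exact hold _ hx h
      · push Not at h
        obtain rfl : j = J := le_antisymm (hJ _ hx) h.1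
        exact hnew t h.2 fun r hr => Or.inl (hE.ordConnected hT₀ hx hr)
    · exact hnew t hx.1 fun r hr => Or.inr ⟨rfl, hr.1, hr.2.trans hx.2⟩

/-- Hybrid time domains with a final point may be continued by a jump there. -/
theorem extend_jump (hE : IsHybridTimeDomain E) {J : ℕ} {T : ℝ} (hJ : ∀ x ∈ E, x.2 ≤ J)
    (hT : ∀ x ∈ E, x.1 ≤ T) (hTJ : (T, J) ∈ E) :
    IsHybridTimeDomain (insert (T, J + 1) E) := by
  constructor
  · rintro x (rfl | hx)
    · exact hE.1 (T, J) hTJ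
    · exact hE.1 x hx
  · rintro x (rfl | hx)
    · obtain ⟨u, hu0, hu, huT, hmem⟩ := hE.exists_jumpTimes hTJ
      refine ⟨J + 2, u, hu0, hu, ?_⟩
      ext ⟨r, k⟩
      simp only [mem_inter_iff, mem_insert_iff, Prod.mk.injEq, mem_ofPred_eq]
      constructor
      · rintro ⟨⟨rfl, rfl⟩ | h1, h2, h3⟩
        · simp [huT (J + 1) (by omega), huT (J + 1 + 1) (by omega)]
        · have := hJ _ h1
          exact ⟨by omega, (hmem r k this).1 ⟨h1, h2⟩⟩
      · rintro ⟨hk, hr⟩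
        rcases Nat.lt_or_ge J k with hk' | hk'
        · obtain rfl : k = J + 1 := by omega
          rw [huT (J + 1) (by omega), huT (J + 1 + 1) (by omega)] at hr
          obtain rfl : r = T := le_antisymm hr.2 hr.1
          exact ⟨Or.inl ⟨rfl, rfl⟩, le_rfl, le_rfl⟩
        · have := (hmem r k hk').2 hr
          exact ⟨Or.inr this.1, this.2, by omega⟩
    · convert hE.2 x hx using 1
      ext y
      simp only [mem_inter_iff, mem_insert_iff, mem_ofPred_eq]
      constructor
      · rintro ⟨rfl | h1, h2⟩
        · have := hJ _ hx
          have := h2.2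
          simp only at this
          omega
        · exact ⟨h1, h2⟩
      · rintro ⟨h1, h2⟩; exact ⟨Or.inr h1, h2⟩

end IsHybridTimeDomain

/-! ### Solutions of hybrid systems -/

namespace HybridSignal

theorem Ioo_subset_interior_flowTimes {X : Type*} {φ : HybridSignal X} {s t : ℝ} {j : ℕ}
    (h : Icc s t ⊆ φ.flowTimes j) : Ioo s t ⊆ interior (φ.flowTimes j) :=
  interior_maximal (Ioo_subset_Icc_self.trans h) isOpen_Ioo

variable {X : Type*} [NormedAddCommGroup X] [NormedSpace ℝ X] {H : HybridSystem X}
  {φ : HybridSignal X}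

/-- Solutions stay in the flow set, also at the endpoints of flow intervals, where this is not part
of the definition. -/
theorem IsSolution.mem_flowSet (hφ : IsSolution H φ) (hC : IsClosed H.C) (hD : H.D ⊆ H.C)
    (hG : ∀ ξ ∈ H.D, H.G ξ ⊆ H.C) {t : ℝ} {j : ℕ} (h : (t, j) ∈ φ.dom) : φ.val t j ∈ H.C := by
  refine hφ.isArc.isDomain.induction (P := fun t j => φ.val t j ∈ H.C) ?_ ?_ ?_ h
  · rcases hφ.init with h | h
    · rwa [hC.closure_eq] at h
    · exact hD h
  · intro j s t hst hI hs
    rcases hst.eq_or_lt with rfl | hst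
    · exact hs
    · have hcont := (hφ.isArc.absCont j s t hst.le hI).continuousOn
      rw [uIcc_of_le hst.le] at hcont
      have h1 : ContinuousWithinAt (fun r => φ.val r j) (Ioo s t) t :=
        (hcont t (right_mem_Icc.2 hst.le)).mono Ioo_subset_Icc_self
      have h2 := h1.mem_closure (t := H.C) (by rw [closure_Ioo hst.ne]; exact right_mem_Icc.2 hst.le)
        fun r hr => hφ.flow_mem j r (Ioo_subset_interior_flowTimes hI hr)
      rwa [hC.closure_eq] at h2
  · intro t j h1 h2 _
    have := hφ.jump t j h1 h2
    exact hG _ this.1 this.2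

/-- Along a flow of a solution, a continuously differentiable quantity whose derivative is
nonpositive at the states of the flow set and for the velocities of the flow map does not
increase. The derivative is taken along a straight line through the state. -/
theorem IsSolution.antitone_of_flow [FiniteDimensional ℝ X] (hφ : IsSolution H φ) {U : ℝ × X → ℝ}
    (hU : ContDiff ℝ 1 U)
    (hd : ∀ t, ∀ ξ ∈ H.C, ∀ v ∈ H.F ξ,
      ∃ d ≤ 0, HasDerivAt (fun r : ℝ => U (t + r, ξ + r • v)) d 0) {s t : ℝ} {j : ℕ}
    (hst : s ≤ t) (hI : Icc s t ⊆ φ.flowTimes j) : U (t, φ.val t j) ≤ U (s, φ.val s j) := by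
  have hφj := hφ.isArc.absCont j s t hst hI
  have hpair : AbsolutelyContinuousOnInterval (fun r => (r, φ.val r j)) s t := by
    have h1 : AbsolutelyContinuousOnInterval (fun r => ((r, 0) : ℝ × X)) s t :=
      ContDiffOn.absolutelyContinuousOnInterval (by fun_prop)
    have h2 : AbsolutelyContinuousOnInterval (fun r => ((0, φ.val r j) : ℝ × X)) s t :=
      hφj.comp_contDiff (g := fun ξ => ((0, ξ) : ℝ × X)) (by fun_prop)
    have := h1.fun_add h2
    simpa using this
  refine (hpair.comp_contDiff hU).le_of_ae_hasDerivAt_nonpos hst ?_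
  filter_upwards [hφ.flow j] with r hr hr'
  have hint := Ioo_subset_interior_flowTimes hI hr'
  obtain ⟨v, hv, hdv⟩ := hr hint
  obtain ⟨d, hd0, hd⟩ := hd r _ (hφ.flow_mem j r hint) v hv
  have h1 : HasFDerivAt U (fderiv ℝ U (r, φ.val r j)) (r, φ.val r j) :=
    (hU.differentiable one_ne_zero _).hasFDerivAt
  have h2 : HasDerivAt (fun x : ℝ => (r + x, φ.val r j + x • v)) (1, v) 0 := by
    refine HasDerivAt.prodMk ((hasDerivAt_id 0).const_add r) ?_
    simpa using ((hasDerivAt_id (0 : ℝ)).smul_const v).const_add (φ.val r j)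
  have h3 := HasFDerivAt.comp_hasDerivAt (0 : ℝ) (by simpa using h1) h2
  refine ⟨_, ?_, h1.comp_hasDerivAt r ((hasDerivAt_id r).prodMk hdv)⟩
  rwa [h3.unique hd]

/-- A solution may be continued on its last level by a flow. -/
theorem IsSolution.extend_flow (hφ : IsSolution H φ)
    (hbr : ∀ t j, (t, j) ∈ φ.dom → (t, j + 1) ∈ φ.dom → ∀ s, (s, j) ∈ φ.dom → s ≤ t)
    {J : ℕ} {T₀ T₁ : ℝ} (hJ : ∀ x ∈ φ.dom, x.2 ≤ J) (hT₀ : (T₀, J) ∈ φ.dom) {γ : ℝ → X}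
    (hγ : ∀ t, (t, J) ∈ φ.dom → γ t = φ.val t J)
    (hac : ∀ s t, s ≤ t → Icc s t ⊆ φ.flowTimes J ∪ Icc T₀ T₁ →
      AbsolutelyContinuousOnInterval γ s t)
    (hmem : ∀ t ∈ interior (φ.flowTimes J ∪ Icc T₀ T₁), γ t ∈ H.C)
    (hflow : ∀ᵐ t : ℝ, t ∈ interior (φ.flowTimes J ∪ Icc T₀ T₁) →
      ∃ v ∈ H.F (γ t), HasDerivAt γ v t) :
    IsSolution H ⟨φ.dom ∪ {x | x.2 = J ∧ x.1 ∈ Icc T₀ T₁},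
      fun t j => if j = J then γ t else φ.val t j⟩ := by
  set ψ : HybridSignal X := ⟨φ.dom ∪ {x | x.2 = J ∧ x.1 ∈ Icc T₀ T₁},
    fun t j => if j = J then γ t else φ.val t j⟩ with hψ
  have hval : ∀ t j, (t, j) ∈ φ.dom → ψ.val t j = φ.val t j := by
    intro t j h
    by_cases hj : j = J
    · subst hj; simp [hψ, hγ t h]
    · simp [hψ, hj]
  have hfJ : ψ.flowTimes J = φ.flowTimes J ∪ Icc T₀ T₁ := by
    ext t; simp [flowTimes, hψ]
  have hfj : ∀ j ≠ J, ψ.flowTimes j = φ.flowTimes j := by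
    intro j hj; ext t; simp [flowTimes, hψ, hj]
  have hvJ : (fun t => ψ.val t J) = γ := by funext t; simp [hψ]
  have hvj : ∀ j ≠ J, (fun t => ψ.val t j) = fun t => φ.val t j := by
    intro j hj; funext t; simp [hψ, hj]
  refine ⟨⟨Or.inl hφ.isArc.zero_mem, hφ.isArc.isDomain.extend_flow hbr hJ hT₀, ?_⟩, ?_, ?_, ?_, ?_⟩
  · intro j s t hst hI
    by_cases hj : j = J
    · subst hj; rw [hfJ] at hI; rw [hvJ]; exact hac s t hst hI
    · rw [hfj j hj] at hI; rw [hvj j hj]; exact hφ.isArc.absCont j s t hst hI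
  · rw [hval 0 0 hφ.isArc.zero_mem]; exact hφ.init
  · intro j t ht
    by_cases hj : j = J
    · subst hj; rw [hfJ] at ht; rw [congrFun hvJ t]; exact hmem t ht
    · rw [hfj j hj] at ht; rw [congrFun (hvj j hj) t]; exact hφ.flow_mem j t ht
  · intro j
    by_cases hj : j = J
    · subst hj; rw [hfJ, hvJ]
      filter_upwards [hflow] with t ht
      rwa [congrFun hvJ t]
    · rw [hfj j hj, hvj j hj]
      filter_upwards [hφ.flow j] with t ht
      rwa [congrFun (hvj j hj) t]
  · intro t j h1 h2
    have h2' : (t, j + 1) ∈ φ.dom := by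
      rcases h2 with h2 | ⟨h2, h3⟩
      · exact h2
      · rcases h1 with h1 | ⟨h1, _⟩
        · -- the new level `J` is entered at its first time only
          have h2' : j + 1 = J := h2
          subst h2'
          have h4 : t ≤ T₀ := hφ.isArc.isDomain.le_of_lt_level hbr h1 hT₀ (Nat.lt_succ_self j)
          obtain rfl : t = T₀ := le_antisymm h4 h3.1
          exact hT₀
        · have h1' : j = J := h1
          have h2' : j + 1 = J := h2
          omega
    have hj : j + 1 ≤ J := hJ _ h2'
    have h1' : (t, j) ∈ φ.dom := by
      rcases h1 with h1 | ⟨h1, _⟩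
      · exact h1
      · have h1' : j = J := h1
        omega
    rw [hval t j h1', hval t (j + 1) h2']
    exact hφ.jump t j h1' h2'

/-- A solution with a final point in the jump set may be continued by a jump. -/
theorem IsSolution.extend_jump (hφ : IsSolution H φ) {J : ℕ} {T : ℝ} (hJ : ∀ x ∈ φ.dom, x.2 ≤ J)
    (hT : ∀ x ∈ φ.dom, x.1 ≤ T) (hTJ : (T, J) ∈ φ.dom) (hD : φ.val T J ∈ H.D) {g : X}
    (hg : g ∈ H.G (φ.val T J)) :
    IsSolution H ⟨insert (T, J + 1) φ.dom, fun t j => if j = J + 1 then g else φ.val t j⟩ := by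
  set ψ : HybridSignal X := ⟨insert (T, J + 1) φ.dom,
    fun t j => if j = J + 1 then g else φ.val t j⟩ with hψ
  have hnot : ∀ t, (t, J + 1) ∉ φ.dom := fun t h => by have := hJ _ h; simp at this
  have hval : ∀ t j, j ≠ J + 1 → ψ.val t j = φ.val t j := fun t j h => by simp [hψ, h]
  have hf : ∀ j ≠ J + 1, ψ.flowTimes j = φ.flowTimes j := by
    intro j hj; ext t; simp [flowTimes, hψ, hj]
  have hfJ : ψ.flowTimes (J + 1) = {T} := by
    ext t; simp [flowTimes, hψ, hnot]
  have hvj : ∀ j ≠ J + 1, (fun t => ψ.val t j) = fun t => φ.val t j := by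
    intro j hj; funext t; simp [hψ, hj]
  refine ⟨⟨Or.inr hφ.isArc.zero_mem, hφ.isArc.isDomain.extend_jump hJ hT hTJ, ?_⟩, ?_, ?_, ?_, ?_⟩
  · intro j s t hst hI
    by_cases hj : j = J + 1
    · subst hj
      have : (fun t => ψ.val t (J + 1)) = fun _ => g := by funext t; simp [hψ]
      rw [this]
      exact ContDiffOn.absolutelyContinuousOnInterval (by fun_prop)
    · rw [hf j hj] at hI; rw [hvj j hj]; exact hφ.isArc.absCont j s t hst hI
  · rw [hval 0 0 (by omega)]; exact hφ.init
  · intro j t ht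
    by_cases hj : j = J + 1
    · subst hj; rw [hfJ, interior_singleton] at ht; exact ht.elim
    · rw [hf j hj] at ht; rw [hval t j hj]; exact hφ.flow_mem j t ht
  · intro j
    by_cases hj : j = J + 1
    · subst hj; rw [hfJ, interior_singleton]; exact ae_of_all _ fun t ht => ht.elim
    · rw [hf j hj, hvj j hj]
      filter_upwards [hφ.flow j] with t ht
      rwa [hval t j hj]
  · intro t j h1 h2
    have hj : j ≠ J + 1 := by
      rintro rfl
      rcases h2 with h2 | h2
      · simp at h2
      · have := hJ _ h2
        simp only at this
        omega
    have h1' : (t, j) ∈ φ.dom := by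
      rcases h1 with h1 | h1
      · simp only [Prod.mk.injEq] at h1
        exact absurd h1.2 hj
      · exact h1
    rw [hval t j hj]
    rcases h2 with h2 | h2
    · simp only [Prod.mk.injEq, Nat.add_right_cancel_iff] at h2
      obtain ⟨rfl, rfl⟩ := h2
      have : ψ.val t (j + 1) = g := by simp [hψ]
      rw [this]
      exact ⟨hD, hg⟩
    · have : j + 1 ≠ J + 1 := by
        intro h; rw [h] at h2; exact hnot _ h2
      rw [hval t _ this]
      exact hφ.jump t j h1' h2

/-- A criterion for completeness of maximal solutions: the flow set is closed and contains the
jump set, jumps are possible on the jump set and stay in the flow set, flows are possible outside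
the jump set and impossible from the jump set, and the velocities along the solution are bounded, so
that it has a limit at the end of a bounded flow interval. -/
theorem IsMaximalSolution.isComplete [FiniteDimensional ℝ X] (hφ : IsMaximalSolution H φ)
    (hC : IsClosed H.C) (hD : H.D ⊆ H.C) (hG : ∀ ξ ∈ H.D, H.G ξ ⊆ H.C)
    (hGne : ∀ ξ ∈ H.D, (H.G ξ).Nonempty)
    (hbr : ∀ t j, (t, j) ∈ φ.dom → φ.val t j ∈ H.D → ∀ s, (s, j) ∈ φ.dom → s ≤ t)
    (hviable : ∀ ξ ∈ H.C, ξ ∉ H.D → ∃ ε > 0, ∃ f : ℝ → X, f 0 = ξ ∧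
      (∃ K, LipschitzOnWith K f (Icc 0 ε)) ∧
      ∀ t ∈ Ioo 0 ε, f t ∈ H.C ∧ ∃ v ∈ H.F (f t), HasDerivAt f v t)
    {K : NNReal} (hK : ∀ t j, (t, j) ∈ φ.dom → ∀ v ∈ H.F (φ.val t j), ‖v‖ ≤ K) :
    φ.IsComplete := by
  by_contra hcon
  simp only [IsComplete, not_forall, not_exists, not_and, not_lt] at hcon
  obtain ⟨B, hB⟩ := hcon
  have hsol := hφ.1
  have hdom := hsol.isArc.isDomain
  have hbr' : ∀ t j, (t, j) ∈ φ.dom → (t, j + 1) ∈ φ.dom → ∀ s, (s, j) ∈ φ.dom → s ≤ t :=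
    fun t j h1 h2 => hbr t j h1 (hsol.jump t j h1 h2).1
  -- the last level
  obtain ⟨J, ⟨t₀, ht₀⟩, hJ⟩ : ∃ J, (∃ t, (t, J) ∈ φ.dom) ∧ ∀ x ∈ φ.dom, x.2 ≤ J := by
    have hbdd : BddAbove {j : ℕ | ∃ t, (t, j) ∈ φ.dom} := by
      refine ⟨⌈B⌉₊, ?_⟩
      rintro j ⟨t, ht⟩
      have h1 := hB _ ht
      have h2 := hdom.1 _ ht
      have h3 : (j : ℝ) ≤ ⌈B⌉₊ := by
        simp only at h1 h2
        linarith [Nat.le_ceil B]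
      exact_mod_cast h3
    have hne : {j : ℕ | ∃ t, (t, j) ∈ φ.dom}.Nonempty := ⟨0, 0, hsol.isArc.zero_mem⟩
    exact ⟨sSup {j : ℕ | ∃ t, (t, j) ∈ φ.dom}, Nat.sSup_mem hne hbdd,
      fun x hx => le_csSup hbdd ⟨x.1, hx⟩⟩
  set I := φ.flowTimes J with hI
  have hIbdd : BddAbove I := ⟨B, fun t ht => by
    have := hB _ ht
    have h2 : (0 : ℝ) ≤ J := Nat.cast_nonneg J
    simp only at this
    linarith⟩
  set T := sSup I with hT
  have hle : ∀ t ∈ I, t ≤ T := fun t ht => le_csSup hIbdd ht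
  have hIoc : ∀ s ∈ I, ∀ t ∈ I, Icc s t ⊆ I := fun s hs t ht r hr => hdom.ordConnected hs ht hr
  have hlip : ∀ s ∈ I, ∀ t ∈ I, s ≤ t → ‖φ.val t J - φ.val s J‖ ≤ K * (t - s) := by
    intro s hs t ht hst
    refine (hsol.isArc.absCont J s t hst (hIoc s hs t ht)).norm_sub_le_of_ae_hasDerivAt hst ?_
    filter_upwards [hsol.flow J] with r hr hr'
    obtain ⟨v, hv, hd⟩ := hr (Ioo_subset_interior_flowTimes (hIoc s hs t ht) hr')
    exact ⟨v, hK r J (hIoc s hs t ht (Ioo_subset_Icc_self hr')) v hv, hd⟩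
  have hlipOn : LipschitzOnWith K (fun t => φ.val t J) I := by
    refine LipschitzOnWith.of_dist_le_mul fun s hs t ht => ?_
    rcases le_total s t with h | h
    · rw [dist_comm, dist_eq_norm, dist_comm, Real.dist_eq, abs_of_nonneg (by linarith)]
      exact hlip s hs t ht h
    · rw [dist_eq_norm, Real.dist_eq, abs_of_nonneg (by linarith)]
      exact hlip t ht s hs h
  -- the last flow interval is closed
  have hTI : T ∈ I := by
    obtain ⟨g, hg, hgeq⟩ := hlipOn.extend_finite_dimension
    have hint : interior (I ∪ Icc t₀ T) ⊆ interior I := by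
      have h1 : interior (I ∪ Icc t₀ T) ⊆ Iio T := by
        rw [← interior_Iic]
        exact interior_mono (union_subset hle fun t ht => ht.2)
      refine interior_maximal (fun t ht => ?_) isOpen_interior
      rcases interior_subset ht with h | h
      · exact h
      · obtain ⟨s, hs, hts⟩ := exists_lt_of_lt_csSup ⟨t₀, ht₀⟩ (h1 ht)
        exact hIoc t₀ ht₀ s hs ⟨h.1, hts.le⟩
    have hext := hsol.extend_flow hbr' (T₁ := T) hJ ht₀ (γ := g) (fun t ht => (hgeq ht).symm)
      (fun s t _ _ => hg.lipschitzOnWith.absolutelyContinuousOnInterval)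
      (fun t ht => by
        rw [← hgeq (interior_subset (hint ht))]
        exact hsol.flow_mem J t (hint ht))
      (by
        filter_upwards [hsol.flow J] with t ht ht'
        obtain ⟨v, hv, hd⟩ := ht (hint ht')
        rw [← hgeq (interior_subset (hint ht'))]
        refine ⟨v, hv, hd.congr_of_eventuallyEq ?_⟩
        filter_upwards [isOpen_interior.mem_nhds (hint ht')] with r hr
        exact (hgeq (interior_subset hr)).symm)
    have := hφ.2 _ hext subset_union_left (fun t j h => by
      by_cases hj : j = J
      · subst hj; simpa using (hgeq h).symm
      · simp [hj])
    exact this (Or.inr ⟨rfl, hle t₀ ht₀, le_rfl⟩)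
  have hTmax : ∀ x ∈ φ.dom, x.1 ≤ T := by
    rintro ⟨t, j⟩ hx
    rcases (hJ _ hx).lt_or_eq with h | h
    · exact hdom.le_of_lt_level hbr' hx hTI h
    · simp only at h
      subst h
      exact hle t hx
  have hξ := hsol.mem_flowSet hC hD hG hTI
  -- at the final point the solution can be continued by a jump or by a flow
  by_cases hξD : φ.val T J ∈ H.D
  · obtain ⟨g, hg⟩ := hGne _ hξD
    have := hφ.2 _ (hsol.extend_jump hJ hTmax hTI hξD hg) (subset_insert _ _) (fun t j h => by
      have : j ≠ J + 1 := fun h' => by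
        have := hJ _ h
        simp only at this
        omega
      simp [this])
    have h2 := hJ _ (this (mem_insert _ _))
    simp at h2
  · obtain ⟨ε, hε, f, hf0, ⟨K', hfL⟩, hf⟩ := hviable _ hξ hξD
    set γ : ℝ → X := fun t => if t ≤ T then φ.val t J else f (t - T) with hγ
    have hγ1 : ∀ t ≤ T, γ t = φ.val t J := fun t ht => by simp [hγ, ht]
    have hγ2 : ∀ t, T ≤ t → γ t = f (t - T) := by
      intro t ht
      rcases ht.eq_or_lt with rfl | h
      · simp [hγ, hf0]
      · simp [hγ, not_le.2 h]
    have hup : ∀ t ∈ I ∪ Icc T (T + ε), t ≤ T + ε := by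
      rintro t (h | h)
      · linarith [hle t h]
      · exact h.2
    have hlow : ∀ t ∈ I ∪ Icc T (T + ε), t ≤ T → t ∈ I := by
      rintro t (h | h) h'
      · exact h
      · obtain rfl : t = T := le_antisymm h' h.1
        exact hTI
    have hlipl : ∀ s ∈ I ∪ Icc T (T + ε), ∀ t, s ≤ t → t ∈ I ∪ Icc T (T + ε) → t ≤ T →
        dist (γ s) (γ t) ≤ max K K' * (t - s) := by
      intro s hs t hst ht htT
      have := hlip s (hlow s hs (hst.trans htT)) t (hlow t ht htT) hst
      rw [hγ1 s (hst.trans htT), hγ1 t htT, dist_comm, dist_eq_norm]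
      refine this.trans (mul_le_mul_of_nonneg_right ?_ (by linarith))
      exact_mod_cast le_max_left K K'
    have hlipr : ∀ s t, T ≤ s → s ≤ t → t ≤ T + ε → dist (γ s) (γ t) ≤ max K K' * (t - s) := by
      intro s t hTs hst ht
      rw [hγ2 s hTs, hγ2 t (hTs.trans hst)]
      have := hfL.dist_le_mul (s - T) ⟨by linarith, by linarith⟩ (t - T)
        ⟨by linarith, by linarith⟩
      rw [dist_comm (s - T), Real.dist_eq, abs_of_nonneg (by linarith)] at this
      have h2 : t - T - (s - T) = t - s := by ring
      rw [h2] at this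
      refine this.trans (mul_le_mul_of_nonneg_right ?_ (by linarith))
      exact_mod_cast le_max_right K K'
    have hlipγ : LipschitzOnWith (max K K') γ (I ∪ Icc T (T + ε)) := by
      have key : ∀ s ∈ I ∪ Icc T (T + ε), ∀ t ∈ I ∪ Icc T (T + ε), s ≤ t →
          dist (γ s) (γ t) ≤ max K K' * (t - s) := by
        intro s hs t ht hst
        rcases le_total t T with h | h
        · exact hlipl s hs t hst ht h
        · rcases le_total s T with h' | h'
          · have h1 := hlipl s hs T h' (Or.inl hTI) le_rfl
            have h2 := hlipr T t le_rfl h (hup t ht)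
            have := dist_triangle (γ s) (γ T) (γ t)
            linarith
          · exact hlipr s t h' hst (hup t ht)
      refine LipschitzOnWith.of_dist_le_mul fun s hs t ht => ?_
      rcases le_total s t with h | h
      · rw [dist_comm s t, Real.dist_eq, abs_of_nonneg (by linarith)]
        exact key s hs t ht h
      · rw [dist_comm, Real.dist_eq, abs_of_nonneg (by linarith)]
        exact key t ht s hs h
    have hint : ∀ t ∈ interior (I ∪ Icc T (T + ε)), t < T + ε := by
      have h1 : interior (I ∪ Icc T (T + ε)) ⊆ Iio (T + ε) := by
        rw [← interior_Iic]
        exact interior_mono hup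
      exact h1
    have hext := hsol.extend_flow hbr' (T₁ := T + ε) hJ hTI (γ := γ) (fun t ht => hγ1 t (hle t ht))
      (fun s t hst hsub => by
        refine LipschitzOnWith.absolutelyContinuousOnInterval (K := max K K') ?_
        rw [uIcc_of_le hst]
        exact hlipγ.mono hsub)
      (fun t ht => by
        rcases le_or_gt t T with h | h
        · rw [hγ1 t h]
          exact hsol.mem_flowSet hC hD hG (hlow t (interior_subset ht) h)
        · rw [hγ2 t h.le]
          exact (hf _ ⟨by linarith, by linarith [hint t ht]⟩).1)
      (by
        have hne : ∀ᵐ t : ℝ, t ≠ T := by simp [ae_iff, measure_singleton]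
        filter_upwards [hsol.flow J, hne] with t ht htne ht'
        rcases lt_or_gt_of_ne htne with h | h
        · have hopen : Iio T ∩ interior (I ∪ Icc T (T + ε)) ⊆ interior I :=
            interior_maximal (fun r hr => hlow r (interior_subset hr.2) (le_of_lt hr.1))
              (isOpen_Iio.inter isOpen_interior)
          obtain ⟨v, hv, hd⟩ := ht (hopen ⟨h, ht'⟩)
          rw [hγ1 t h.le]
          refine ⟨v, hv, hd.congr_of_eventuallyEq ?_⟩
          filter_upwards [isOpen_Iio.mem_nhds h] with r hr
          exact hγ1 r (le_of_lt hr)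
        · obtain ⟨v, hv, hd⟩ := (hf (t - T) ⟨by linarith, by linarith [hint t ht']⟩).2
          rw [hγ2 t h.le]
          refine ⟨v, hv, (hd.comp_sub_const t T).congr_of_eventuallyEq ?_⟩
          filter_upwards [isOpen_Ioi.mem_nhds h] with r hr
          exact hγ2 r (le_of_lt hr))
    have := hφ.2 _ hext subset_union_left (fun t j h => by
      by_cases hj : j = J
      · subst hj; simpa using hγ1 t (hle t h)
      · simp [hj])
    have h2 := hle (T + ε) (this (Or.inr ⟨rfl, by linarith, le_rfl⟩))
    linarith

end HybridSignal

namespace ChronoSync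

/-! ### Quadratic forms and extreme eigenvalues -/

theorem dotProduct_mulVec_comm {n : Type*} [Fintype n] {A : Matrix n n ℝ} (hA : A.IsHermitian)
    (x y : n → ℝ) : x ⬝ᵥ A *ᵥ y = y ⬝ᵥ A *ᵥ x := by
  have hT : Aᵀ = A := by simpa using hA.eq
  rw [dotProduct_mulVec, ← mulVec_transpose, dotProduct_comm, hT]

/-- Young's inequality for the form of a positive semidefinite matrix. -/
theorem two_mul_dotProduct_mulVec_le {n : Type*} [Fintype n] {A : Matrix n n ℝ}
    (hA : A.PosSemidef) {κ : ℝ} (hκ : 0 < κ) (x y : n → ℝ) :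
    2 * (x ⬝ᵥ A *ᵥ y) ≤ κ * (x ⬝ᵥ A *ᵥ x) + 1 / κ * (y ⬝ᵥ A *ᵥ y) := by
  have h := hA.dotProduct_mulVec_nonneg (κ • x - y)
  have hsymm := dotProduct_mulVec_comm hA.1 y x
  simp only [star_trivial, mulVec_sub, mulVec_smul, dotProduct_sub, sub_dotProduct,
    dotProduct_smul, smul_dotProduct, smul_eq_mul, hsymm] at h
  have h3 : κ * (κ * (x ⬝ᵥ A *ᵥ x) + 1 / κ * (y ⬝ᵥ A *ᵥ y) - 2 * (x ⬝ᵥ A *ᵥ y)) =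
      κ * (κ * (x ⬝ᵥ A *ᵥ x) - x ⬝ᵥ A *ᵥ y) - (κ * (x ⬝ᵥ A *ᵥ y) - y ⬝ᵥ A *ᵥ y) := by
    field_simp
    ring
  rw [← h3] at h
  linarith [nonneg_of_mul_nonneg_right h hκ]

section QuadraticForms

variable {n : Type*} [Fintype n] [DecidableEq n] {A : Matrix n n ℝ}

theorem dotProduct_mulVec_le_lamMax (hA : A.IsHermitian) (x : n → ℝ) :
    x ⬝ᵥ A *ᵥ x ≤ lamMax A * (x ⬝ᵥ x) := by
  have hB : (algebraMap ℝ (Matrix n n ℝ) (lamMax A) - A).IsHermitian := by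
    rw [Algebra.algebraMap_eq_smul_one]
    exact ((isHermitian_one (n := n) (α := ℝ)).smul (IsSelfAdjoint.all _)).sub hA
  have hpsd : (algebraMap ℝ (Matrix n n ℝ) (lamMax A) - A).PosSemidef := by
    rw [hB.posSemidef_iff_eigenvalues_nonneg]
    intro i
    have h1 := hB.eigenvalues_mem_spectrum_real i
    rw [← spectrum.singleton_sub_eq] at h1
    obtain ⟨_, rfl, l, hl, h⟩ := h1
    have h2 : l ≤ lamMax A := le_csSup A.finite_real_spectrum.bddAbove hl
    simp only at h
    change 0 ≤ hB.eigenvalues i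
    linarith
  have := hpsd.dotProduct_mulVec_nonneg x
  rw [Algebra.algebraMap_eq_smul_one, sub_mulVec, smul_mulVec, one_mulVec, dotProduct_sub,
    dotProduct_smul, star_trivial, smul_eq_mul] at this
  linarith

theorem lamMin_le_dotProduct_mulVec (hA : A.IsHermitian) (x : n → ℝ) :
    lamMin A * (x ⬝ᵥ x) ≤ x ⬝ᵥ A *ᵥ x := by
  have h := dotProduct_mulVec_le_lamMax hA.neg x
  have h2 : lamMax (-A) = -lamMin A := by
    rw [lamMax, lamMin, ← spectrum.neg_eq, Real.sSup_neg]
  rw [h2, neg_mulVec, dotProduct_neg] at h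
  linarith

/-- Each eigenvalue is the value of the quadratic form at a unit vector. -/
theorem exists_dotProduct_mulVec_eq_of_mem_spectrum (hA : A.IsHermitian) {l : ℝ}
    (hl : l ∈ spectrum ℝ A) : ∃ x : n → ℝ, x ⬝ᵥ x = 1 ∧ x ⬝ᵥ A *ᵥ x = l := by
  rw [hA.spectrum_real_eq_range_eigenvalues] at hl
  obtain ⟨i, rfl⟩ := hl
  have h1 : (hA.eigenvectorBasis i).ofLp ⬝ᵥ (hA.eigenvectorBasis i).ofLp = 1 := by
    have := hA.eigenvectorBasis.orthonormal.1 i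
    rw [dotProduct, ← one_pow 2, ← this, EuclideanSpace.real_norm_sq_eq]
    exact Finset.sum_congr rfl fun k _ => (sq _).symm
  refine ⟨_, h1, ?_⟩
  rw [hA.mulVec_eigenvectorBasis, dotProduct_smul, h1, smul_eq_mul, mul_one]

theorem spectrum_real_nonempty [Nonempty n] (hA : A.IsHermitian) : (spectrum ℝ A).Nonempty :=
  ⟨_, hA.eigenvalues_mem_spectrum_real (Classical.arbitrary n)⟩

theorem lamMax_le [Nonempty n] (hA : A.IsHermitian) {c : ℝ}
    (h : ∀ x, x ⬝ᵥ A *ᵥ x ≤ c * (x ⬝ᵥ x)) : lamMax A ≤ c := by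
  refine csSup_le (spectrum_real_nonempty hA) fun l hl => ?_
  obtain ⟨x, hx, rfl⟩ := exists_dotProduct_mulVec_eq_of_mem_spectrum hA hl
  simpa [hx] using h x

theorem lamMin_pos [Nonempty n] (hA : A.PosDef) : 0 < lamMin A := by
  have := (spectrum_real_nonempty hA.1).csInf_mem A.finite_real_spectrum
  obtain ⟨x, hx, h⟩ := exists_dotProduct_mulVec_eq_of_mem_spectrum hA.1 this
  have hx0 : x ≠ 0 := by rintro rfl; simp at hx
  have h2 := hA.dotProduct_mulVec_pos hx0
  rw [star_trivial, h] at h2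
  exact h2

theorem dotProduct_mulVec_le_specNorm (A : Matrix n n ℝ) (x : n → ℝ) :
    x ⬝ᵥ A *ᵥ x ≤ specNorm A * (x ⬝ᵥ x) := by
  have h1 := inner_toEuclideanCLM A (WithLp.toLp 2 x) (WithLp.toLp 2 x)
  have h2 := real_inner_le_norm (WithLp.toLp 2 x) (toEuclideanCLM (𝕜 := ℝ) A (WithLp.toLp 2 x))
  have h3 := (toEuclideanCLM (𝕜 := ℝ) A).le_opNorm (WithLp.toLp 2 x)
  have h4 : x ⬝ᵥ x = ‖WithLp.toLp 2 x‖ * ‖WithLp.toLp 2 x‖ := by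
    rw [← sq, EuclideanSpace.real_norm_sq_eq]
    simp [dotProduct, sq]
  rw [h1] at h2
  rw [h4, specNorm]
  simp only at h2
  nlinarith [norm_nonneg (WithLp.toLp 2 x)]

theorem specNorm_pos [Nonempty n] (hA : A.PosDef) : 0 < specNorm A := by
  have h := dotProduct_mulVec_le_specNorm A 1
  have h2 := hA.dotProduct_mulVec_pos (x := 1) one_ne_zero
  rw [star_trivial] at h2
  have h3 : (0 : ℝ) ≤ (1 : n → ℝ) ⬝ᵥ 1 := by simp
  by_contra hcon
  nlinarith

theorem lamMax_pos [Nonempty n] (hA : A.PosDef) : 0 < lamMax A := by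
  have h := dotProduct_mulVec_le_lamMax hA.1 1
  have h2 := hA.dotProduct_mulVec_pos (x := 1) one_ne_zero
  rw [star_trivial] at h2
  have h3 : (0 : ℝ) ≤ (1 : n → ℝ) ⬝ᵥ 1 := by simp
  by_contra hcon
  nlinarith

end QuadraticForms

variable {N : ℕ} {S : Network N} {V : Matrix (Fin N) (Fin (N - 1)) ℝ}
  {D : Matrix (Fin (N - 1)) (Fin (N - 1)) ℝ} {Λ : LyapunovData N}

/-! ### The Lyapunov matrices -/

/-- The part of the form of `P(τ)` that does not depend on the timers. -/
def constForm (Λ : LyapunovData N) (x y : ZIdx N → ℝ) : ℝ :=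
  (fun i => x (Sum.inl i)) ⬝ᵥ Λ.P₁ *ᵥ (fun i => y (Sum.inl i)) +
    (fun i => x (Sum.inr (Sum.inr i))) ⬝ᵥ Λ.P₃ *ᵥ (fun i => y (Sum.inr (Sum.inr i)))

/-- The form of `P(τ)` splits into a timer-independent part and the weighted squares of `ϑ̃`. -/
theorem dotProduct_PMat_mulVec (τ : Fin N → ℝ) (x y : ZIdx N → ℝ) :
    x ⬝ᵥ PMat Λ τ *ᵥ y = constForm Λ x y +
      ∑ p, Λ.p₂ p * Real.exp (Λ.σ * τ p) * (x (Sum.inr (Sum.inl p)) * y (Sum.inr (Sum.inl p))) := by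
  rw [PMat, fromBlocks_mulVec, fromBlocks_mulVec]
  simp only [dotProduct, Fintype.sum_sum_type, Sum.elim_inl, Sum.elim_inr, zero_mulVec, add_zero,
    zero_add, constForm, P2, mulVec_diagonal, Function.comp_def, mul_left_comm (x (Sum.inr (Sum.inl _)))]
  ring

theorem PMat_posDef (Λ : LyapunovData N) (τ : Fin N → ℝ) : (PMat Λ τ).PosDef := by
  refine PosDef.of_dotProduct_mulVec_pos ?_ fun x hx => ?_
  · exact Λ.P₁_posDef.1.fromBlocks (by simp)
      (IsHermitian.fromBlocks (isHermitian_diagonal _) (by simp) Λ.P₃_posDef.1)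
  · have h1 := Λ.P₁_posDef.posSemidef.dotProduct_mulVec_nonneg fun i => x (Sum.inl i)
    have h3 := Λ.P₃_posDef.posSemidef.dotProduct_mulVec_nonneg fun i => x (Sum.inr (Sum.inr i))
    have hw : ∀ p, 0 < Λ.p₂ p * Real.exp (Λ.σ * τ p) := fun p =>
      mul_pos (Λ.p₂_pos p) (Real.exp_pos _)
    have h2 : 0 ≤ ∑ p, Λ.p₂ p * Real.exp (Λ.σ * τ p) *
        (x (Sum.inr (Sum.inl p)) * x (Sum.inr (Sum.inl p))) :=
      Finset.sum_nonneg fun p _ => mul_nonneg (hw p).le (mul_self_nonneg _)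
    rw [star_trivial] at h1 h3 ⊢
    rw [dotProduct_PMat_mulVec, constForm]
    obtain ⟨i, hi⟩ := Function.ne_iff.1 hx
    rcases i with i | i | i
    · have := Λ.P₁_posDef.dotProduct_mulVec_pos (x := fun i => x (Sum.inl i))
        (fun h => hi (congrFun h i))
      rw [star_trivial] at this
      linarith
    · have : 0 < ∑ p, Λ.p₂ p * Real.exp (Λ.σ * τ p) *
          (x (Sum.inr (Sum.inl p)) * x (Sum.inr (Sum.inl p))) :=
        Finset.sum_pos' (fun p _ => mul_nonneg (hw p).le (mul_self_nonneg _))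
          ⟨i, Finset.mem_univ i, mul_pos (hw i) (mul_self_pos.2 hi)⟩
      linarith
    · have := Λ.P₃_posDef.dotProduct_mulVec_pos (x := fun i => x (Sum.inr (Sum.inr i)))
        (fun h => hi (congrFun h i))
      rw [star_trivial] at this
      linarith

theorem dotProduct_PMat_mulVec_mono {τ τ' : Fin N → ℝ} (h : ∀ p, τ p ≤ τ' p) (x : ZIdx N → ℝ) :
    x ⬝ᵥ PMat Λ τ *ᵥ x ≤ x ⬝ᵥ PMat Λ τ' *ᵥ x := by
  simp only [dotProduct_PMat_mulVec]
  gcongr with p _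
  · exact mul_self_nonneg _
  · exact (Λ.p₂_pos p).le
  · exact Λ.σ_pos.le
  · exact h p

theorem dotProduct_QMat_mulVec (τ : Fin N → ℝ) (x : ZIdx N → ℝ) :
    x ⬝ᵥ QMat S Λ τ *ᵥ x = -(Λ.σ * bMin S) *
      ∑ p, Λ.p₂ p * Real.exp (Λ.σ * τ p) * (x (Sum.inr (Sum.inl p)) * x (Sum.inr (Sum.inl p))) := by
  rw [QMat, smul_mulVec, dotProduct_smul, fromBlocks_mulVec, fromBlocks_mulVec, smul_eq_mul]
  congr 1
  simp only [dotProduct, Fintype.sum_sum_type, Sum.elim_inl, Sum.elim_inr, zero_mulVec, add_zero,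
    zero_add, P2, mulVec_diagonal, Function.comp_def, Pi.zero_apply, mul_zero,
    Finset.sum_const_zero]
  exact Finset.sum_congr rfl fun p _ => by ring

theorem dotProduct_MMat_mulVec (τ : Fin N → ℝ) (x : ZIdx N → ℝ) :
    x ⬝ᵥ MMat S V D Λ τ *ᵥ x =
      2 * (x ⬝ᵥ PMat Λ τ *ᵥ (flowMatrix S V D *ᵥ x)) + x ⬝ᵥ QMat S Λ τ *ᵥ x := by
  have hsymm : (PMat Λ τ)ᵀ = PMat Λ τ := by simpa using (PMat_posDef Λ τ).1.eq
  have h1 : x ⬝ᵥ ((flowMatrix S V D)ᵀ * PMat Λ τ) *ᵥ x =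
      x ⬝ᵥ (PMat Λ τ * flowMatrix S V D) *ᵥ x := by
    rw [dotProduct_mulVec, ← mulVec_transpose, dotProduct_comm, transpose_mul, hsymm,
      transpose_transpose]
  rw [MMat, add_mulVec, add_mulVec, dotProduct_add, dotProduct_add, h1, mulVec_mulVec]
  ring

theorem isCompact_timerBox (S : Network N) : IsCompact (timerBox S) := by
  have : timerBox S = Set.pi univ fun p => Icc 0 (S.T₂ p) := by ext; simp only [timerBox, mem_ofPred_eq, mem_univ_pi]
  rw [this]
  exact isCompact_univ_pi fun p => isCompact_Icc

theorem T₂_nonneg (S : Network N) (p : Fin N) : 0 ≤ S.T₂ p :=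
  (S.T₁_pos p).le.trans (S.T₁_le_T₂ p)

theorem zero_mem_timerBox (S : Network N) : (0 : Fin N → ℝ) ∈ timerBox S :=
  fun p => ⟨le_rfl, T₂_nonneg S p⟩

theorem continuous_MMat : Continuous fun τ => MMat S V D Λ τ := by
  have h2 : Continuous fun τ => P2 Λ τ := by unfold P2; fun_prop
  have hP : Continuous fun τ => PMat Λ τ :=
    continuous_const.matrix_fromBlocks continuous_const continuous_const
      (h2.matrix_fromBlocks continuous_const continuous_const continuous_const)
  have hQ : Continuous fun τ => QMat S Λ τ :=
    (continuous_const.matrix_fromBlocks continuous_const continuous_const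
      (h2.matrix_fromBlocks continuous_const continuous_const continuous_const)).const_smul
      (-(Λ.σ * bMin S))
  exact ((continuous_const.matrix_mul hP).add (hP.matrix_mul continuous_const)).add hQ

/-- By compactness of the timer box, negative definiteness of `M(τ)` is uniform in `τ`. -/
theorem exists_uniform_negative [Nonempty (ZIdx N)]
    (hM : ∀ τ ∈ timerBox S, (-MMat S V D Λ τ).PosDef) :
    ∃ c > 0, ∀ τ ∈ timerBox S, ∀ x : ZIdx N → ℝ, x ⬝ᵥ MMat S V D Λ τ *ᵥ x ≤ -c * (x ⬝ᵥ x) := by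
  have hK : IsCompact (timerBox S ×ˢ Metric.sphere (0 : EuclideanSpace ℝ (ZIdx N)) 1) :=
    (isCompact_timerBox S).prod (isCompact_sphere _ _)
  have hne : (timerBox S ×ˢ Metric.sphere (0 : EuclideanSpace ℝ (ZIdx N)) 1).Nonempty :=
    Set.Nonempty.prod ⟨0, zero_mem_timerBox S⟩ (NormedSpace.sphere_nonempty.2 zero_le_one)
  have hcont : Continuous fun q : (Fin N → ℝ) × EuclideanSpace ℝ (ZIdx N) =>
      q.2.ofLp ⬝ᵥ MMat S V D Λ q.1 *ᵥ q.2.ofLp := by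
    have h2 : Continuous fun q : (Fin N → ℝ) × EuclideanSpace ℝ (ZIdx N) => q.2.ofLp := by fun_prop
    exact h2.dotProduct ((continuous_MMat.comp continuous_fst).matrix_mulVec h2)
  obtain ⟨q, hq, hmax⟩ := hK.exists_isMaxOn hne hcont.continuousOn
  have hneg : ∀ τ ∈ timerBox S, ∀ x : ZIdx N → ℝ, x ≠ 0 → x ⬝ᵥ MMat S V D Λ τ *ᵥ x < 0 := by
    intro τ hτ x hx
    have := (hM τ hτ).dotProduct_mulVec_pos hx
    rw [star_trivial, neg_mulVec, dotProduct_neg] at this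
    linarith
  have hq0 : q.2.ofLp ≠ 0 := by
    intro h
    have h2 : q.2 = 0 := by ext i; exact congrFun h i
    have h3 := hq.2
    rw [h2] at h3
    simp at h3
  refine ⟨_, neg_pos.2 (hneg q.1 hq.1 _ hq0), fun τ hτ x => ?_⟩
  rw [neg_neg]
  rcases eq_or_ne x 0 with rfl | hx
  · simp
  · set y : EuclideanSpace ℝ (ZIdx N) := WithLp.toLp 2 x with hy
    have hy0 : 0 < ‖y‖ := by
      rw [norm_pos_iff]
      intro h
      exact hx (by simpa [hy] using h)
    have hxx : x ⬝ᵥ x = ‖y‖ ^ 2 := by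
      rw [EuclideanSpace.real_norm_sq_eq]; simp [hy, dotProduct, sq]
    have := hmax (a := (τ, ‖y‖⁻¹ • y)) ⟨hτ, by simp [norm_smul, hy0.ne']⟩
    simp only [mem_ofPred_eq, WithLp.ofLp_smul, mulVec_smul, dotProduct_smul, smul_dotProduct,
      smul_eq_mul, hy] at this
    rw [hxx]
    rw [← hy, ← mul_assoc, ← sq, inv_pow, inv_mul_le_iff₀ (by positivity)] at this
    linarith

/-- `μ` is positive and the form of `M(τ)` is at most `-μ ‖x‖²` on the whole timer box. Both rest on
the uniform bound, which also makes the set in the definition of `μ` bounded above. -/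
theorem mu_pos_and_dotProduct_MMat_mulVec_le [Nonempty (ZIdx N)]
    (hM : ∀ τ ∈ timerBox S, (-MMat S V D Λ τ).PosDef) :
    0 < mu S V D Λ ∧ ∀ τ ∈ timerBox S, ∀ x : ZIdx N → ℝ,
      x ⬝ᵥ MMat S V D Λ τ *ᵥ x ≤ -mu S V D Λ * (x ⬝ᵥ x) := by
  obtain ⟨c, hc, h⟩ := exists_uniform_negative hM
  have hH : ∀ τ ∈ timerBox S, (MMat S V D Λ τ).IsHermitian := fun τ hτ => by
    simpa using (hM τ hτ).1.neg
  have hle : ∀ l ∈ (fun τ => lamMax (MMat S V D Λ τ)) '' timerBox S, l ≤ -c := by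
    rintro _ ⟨τ, hτ, rfl⟩
    exact lamMax_le (hH τ hτ) (h τ hτ)
  refine ⟨?_, fun τ hτ x => ?_⟩
  · have := csSup_le (Set.Nonempty.image _ ⟨0, zero_mem_timerBox S⟩) hle
    rw [mu]
    linarith
  · refine (dotProduct_mulVec_le_lamMax (hH τ hτ) x).trans
      (mul_le_mul_of_nonneg_right ?_ (dotProduct_self_star_nonneg x))
    rw [mu, neg_neg]
    exact le_csSup ⟨-c, hle⟩ ⟨τ, hτ, rfl⟩

/-! ### The orthonormal basis of Laplacian eigenvectors -/

/-- `V Vᵀ` is the orthogonal projection onto the complement of the all-ones vector. -/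
theorem IsLaplacianEigenbasis.mul_transpose (hN : 2 ≤ N) (hVD : IsLaplacianEigenbasis S V D) :
    V * Vᵀ = 1 - (N : ℝ)⁻¹ • of fun _ _ => 1 := by
  have hN0 : (0 : ℝ) < N := by exact_mod_cast (by omega : 0 < N)
  set u : Matrix (Fin N) Unit ℝ := of fun _ _ => (√N)⁻¹ with hu
  have hVu : Vᵀ * u = 0 := by
    ext i k
    have := congrFun hVD.orthogonal_ones i
    simp only [mulVec, dotProduct, mul_one, Pi.zero_apply] at this
    simp only [hu, mul_apply, of_apply, ← Finset.sum_mul, this, zero_mul, Matrix.zero_apply]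
  -- the square matrix `[V u]` is orthogonal, so its rows are orthonormal as well
  have hUU : (fromCols V u)ᵀ * fromCols V u = 1 := by
    rw [transpose_fromCols, fromRows_mul_fromCols, hVD.orthonormal, hVu, ← fromBlocks_one]
    congr 1
    · rw [← transpose_inj]; simpa using hVu
    · ext; simp [hu, mul_apply, ← sq, inv_pow, Real.sq_sqrt hN0.le, hN0.ne']
  have hcard : Fintype.card (Fin (N - 1) ⊕ Unit) = Fintype.card (Fin N) := by
    simp; omega
  have h := (Matrix.mul_eq_one_comm_of_card_eq (Fin (N - 1) ⊕ Unit) (Fin N) ℝ hcard).1 hUU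
  rw [transpose_fromCols, fromCols_mul_fromRows] at h
  rw [← h, eq_sub_iff_add_eq]
  congr 1
  ext; simp [hu, mul_apply, ← sq, inv_pow, Real.sq_sqrt hN0.le]

/-- The projections `η = Vᵀ ϑ` control all differences of software clocks. -/
theorem IsLaplacianEigenbasis.abs_sub_le (hN : 2 ≤ N) (hVD : IsLaplacianEigenbasis S V D)
    (ϑ : Fin N → ℝ) (p q : Fin N) :
    |ϑ p - ϑ q| ≤ √2 * √((Vᵀ *ᵥ ϑ) ⬝ᵥ (Vᵀ *ᵥ ϑ)) := by
  have hVV := hVD.mul_transpose hN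
  have h1 : (Vᵀ *ᵥ ϑ) ⬝ᵥ (Vᵀ *ᵥ ϑ) = ∑ i, (ϑ i - (N : ℝ)⁻¹ * ∑ k, ϑ k) ^ 2 := by
    set m := (N : ℝ)⁻¹ * ∑ k, ϑ k with hm
    have hN0 : (N : ℝ) ≠ 0 := by exact_mod_cast (by omega : N ≠ 0)
    have hsum : ∑ k, ϑ k = N * m := by rw [hm]; field_simp
    have h3 : (V * Vᵀ) *ᵥ ϑ = fun i => ϑ i - m := by
      rw [hVV, sub_mulVec, one_mulVec, smul_mulVec]
      ext i; simp [mulVec, dotProduct, hm]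
    rw [dotProduct_mulVec, ← mulVec_transpose, transpose_transpose, mulVec_mulVec, h3, dotProduct_comm]
    have h4 : ∑ i, (ϑ i - m) = 0 := by simp [hsum]
    have h5 : ∑ i, (ϑ i - m) ^ 2 = ∑ i, ϑ i * (ϑ i - m) - m * ∑ i, (ϑ i - m) := by
      rw [Finset.mul_sum, ← Finset.sum_sub_distrib]
      exact Finset.sum_congr rfl fun i _ => by ring
    rw [h5, h4]
    simp [dotProduct]
  rw [h1, ← Real.sqrt_mul (by norm_num)]
  refine Real.abs_le_sqrt ?_
  rcases eq_or_ne p q with rfl | hpq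
  · simpa using Finset.sum_nonneg fun i _ => sq_nonneg _
  · have h2 := Finset.sum_le_sum_of_subset_of_nonneg (Finset.subset_univ {p, q})
      (f := fun i => (ϑ i - (N : ℝ)⁻¹ * ∑ k, ϑ k) ^ 2) fun i _ _ => sq_nonneg _
    rw [Finset.sum_pair hpq] at h2
    nlinarith [sq_nonneg ((ϑ p - (N : ℝ)⁻¹ * ∑ k, ϑ k) + (ϑ q - (N : ℝ)⁻¹ * ∑ k, ϑ k))]

/-! ### Geometry of the state space -/

theorem dotProduct_self_eq_norm_sq {n : Type*} [Fintype n] (x : EuclideanSpace ℝ n) :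
    x.ofLp ⬝ᵥ x.ofLp = ‖x‖ ^ 2 := by
  rw [EuclideanSpace.real_norm_sq_eq]; simp [dotProduct, sq]

theorem norm_sq_eq_zPart_add_tau (ξ : State N) : ‖ξ‖ ^ 2 = ‖zPart ξ‖ ^ 2 + ∑ p, tau ξ p ^ 2 := by
  simp [EuclideanSpace.real_norm_sq_eq, zPart, tau, Fintype.sum_sum_type]

theorem norm_zPart_le (ξ : State N) : ‖zPart ξ‖ ≤ ‖ξ‖ := by
  refine le_of_sq_le_sq ?_ (norm_nonneg _)
  rw [norm_sq_eq_zPart_add_tau ξ]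
  linarith [Finset.sum_nonneg fun (p : Fin N) (_ : p ∈ Finset.univ) => sq_nonneg (tau ξ p)]

theorem continuous_tau : Continuous (tau : State N → Fin N → ℝ) := by
  unfold tau; fun_prop

theorem isClosed_flowSet (S : Network N) : IsClosed (flowSet S) :=
  (isCompact_timerBox S).isClosed.preimage continuous_tau

theorem continuous_zPart : Continuous (zPart : State N → EuclideanSpace ℝ (ZIdx N)) := by
  unfold zPart; fun_prop

theorem isClosed_attractor (S : Network N) : IsClosed (attractor S) :=
  (isClosed_flowSet S).inter (isClosed_eq continuous_zPart.norm continuous_const)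

/-- On the flow set, the distance to the attractor is the norm of `z`. -/
theorem infDist_attractor {ξ : State N} (hξ : ξ ∈ flowSet S) :
    Metric.infDist ξ (attractor S) = ‖zPart ξ‖ := by
  set y : State N := WithLp.toLp 2 (Sum.elim 0 (tau ξ)) with hy
  have hyz : zPart y = 0 := by ext i; simp [zPart, hy]
  have hyt : tau y = tau ξ := by ext i; simp [tau, hy]
  have hyA : y ∈ attractor S := ⟨by simpa [flowSet, hyt] using hξ, by simp [hyz]⟩
  refine le_antisymm ?_ ?_
  · refine (Metric.infDist_le_dist_of_mem hyA).trans ?_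
    rw [dist_eq_norm]
    refine le_of_sq_le_sq ?_ (norm_nonneg _)
    rw [norm_sq_eq_zPart_add_tau]
    have h1 : zPart (ξ - y) = zPart ξ - zPart y := rfl
    have h2 : ∀ p, tau (ξ - y) p = tau ξ p - tau y p := fun p => rfl
    simp [h1, h2, hyz, hyt]
  · refine (Metric.le_infDist ⟨y, hyA⟩).2 fun x hx => ?_
    have hx0 : zPart x = 0 := norm_eq_zero.1 hx.2
    have h1 : zPart (ξ - x) = zPart ξ - zPart x := rfl
    rw [dist_eq_norm]
    simpa [h1, hx0] using norm_zPart_le (ξ - x)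

theorem isCompact_disturbances (S : Network N) : IsCompact (disturbances S) := by
  have : disturbances S = Set.pi univ fun p => Icc (-S.δ p) (S.δ p) := by
    ext; simp only [disturbances, mem_ofPred_eq, mem_univ_pi]
  rw [this]
  exact isCompact_univ_pi fun p => isCompact_Icc

theorem bddAbove_norm_Pz (S : Network N) (V : Matrix (Fin N) (Fin (N - 1)) ℝ) :
    BddAbove ((fun w => ‖w‖) '' Pz S V) := by
  have h : Continuous fun d : Fin N → ℝ => ‖mkZ (Vᵀ *ᵥ d) d 0 d‖ := by
    unfold mkZ
    refine continuous_norm.comp ((PiLp.continuous_toLp 2 _).comp (continuous_pi ?_))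
    rintro (i | i | i | i)
    · exact (continuous_apply i).comp (continuous_const.matrix_mulVec continuous_id)
    · exact continuous_apply i
    · exact continuous_const
    · exact continuous_apply i
  refine ((isCompact_disturbances S).image h).bddAbove.mono ?_
  rintro _ ⟨_, ⟨d, hd, rfl⟩, rfl⟩
  exact ⟨d, hd, rfl⟩

theorem norm_le_deltaMax {w : EuclideanSpace ℝ (ZIdx N)} (hw : w ∈ Pz S V) :
    ‖w‖ ≤ deltaMax S V :=
  le_csSup (bddAbove_norm_Pz S V) ⟨w, hw, rfl⟩

theorem deltaMax_nonneg (S : Network N) (V : Matrix (Fin N) (Fin (N - 1)) ℝ) :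
    0 ≤ deltaMax S V :=
  Real.sSup_nonneg (by rintro _ ⟨w, _, rfl⟩; exact norm_nonneg _)

theorem deltaMax_pos (h : ∃ p, 0 < S.δ p) : 0 < deltaMax S V := by
  obtain ⟨p, hp⟩ := h
  have hmem : mkZ (Vᵀ *ᵥ S.δ) S.δ 0 S.δ ∈ Pz S V :=
    ⟨S.δ, fun q => ⟨by linarith [S.δ_nonneg q], le_rfl⟩, rfl⟩
  refine lt_of_lt_of_le (norm_pos_iff.2 fun h0 => ?_) (norm_le_deltaMax hmem)
  have := congrArg (fun x : EuclideanSpace ℝ (ZIdx N) => x (Sum.inr (Sum.inl p))) h0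
  simp [mkZ] at this
  exact hp.ne' this

theorem bMin_le (S : Network N) (p : Fin N) : bMin S ≤ S.b p - S.δ p :=
  ciInf_le (Set.finite_range _).bddBelow p

theorem le_bMax (S : Network N) (p : Fin N) : S.b p + S.δ p ≤ bMax S :=
  le_ciSup (f := fun p => S.b p + S.δ p) (Set.finite_range _).bddAbove p

theorem TMin_le (S : Network N) (p : Fin N) : TMin S ≤ S.T₁ p :=
  ciInf_le (Set.finite_range _).bddBelow p

theorem bMax_pos [Nonempty (Fin N)] (S : Network N) : 0 < bMax S := by
  have p := Classical.arbitrary (Fin N)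
  linarith [le_bMax S p, S.δ_lt_b p, S.δ_nonneg p]

theorem TMin_pos [Nonempty (Fin N)] (S : Network N) : 0 < TMin S := by
  obtain ⟨p, hp⟩ := exists_eq_ciInf_of_finite (f := S.T₁)
  rw [TMin, ← hp]
  exact S.T₁_pos p

theorem tau_of_mem_flowMap {ξ v : State N} (hv : v ∈ flowMap S V D ξ) (p : Fin N) :
    -(S.b p + S.δ p) ≤ tau v p ∧ tau v p ≤ -(S.b p - S.δ p) := by
  obtain ⟨_, d, hd, hτ⟩ := hv
  have := hd p
  rw [hτ]
  simp only [Pi.add_apply, Pi.neg_apply]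
  exact ⟨by linarith [this.1], by linarith [this.2]⟩

theorem jumpSet_subset_flowSet (S : Network N) : jumpSet S ⊆ flowSet S :=
  iUnion_subset fun _ _ h => h.1

theorem jumpMap_subset_flowSet (ξ : State N) : jumpMap S ξ ⊆ flowSet S := by
  rintro g ⟨p, hp, hg⟩ q
  obtain ⟨_, _, _, _, hp', hq⟩ := hg
  by_cases hqp : q = p
  · subst hqp
    exact ⟨(S.T₁_pos q).le.trans hp'.1, hp'.2⟩
  · rw [hq q hqp]
    exact hp.1 q

/-! ### The Lyapunov function -/

/-- The Lyapunov function `zᵀ P(τ) z`. -/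
noncomputable def lyap (Λ : LyapunovData N) (ξ : State N) : ℝ :=
  (zPart ξ).ofLp ⬝ᵥ PMat Λ (tau ξ) *ᵥ (zPart ξ).ofLp

theorem lyap_eq (ξ : State N) : lyap Λ ξ = constForm Λ (zPart ξ).ofLp (zPart ξ).ofLp +
    ∑ p, Λ.p₂ p * Real.exp (Λ.σ * tau ξ p) * (vtilde ξ p * vtilde ξ p) :=
  dotProduct_PMat_mulVec _ _ _

theorem contDiff_lyap (Λ : LyapunovData N) : ContDiff ℝ 1 (lyap Λ) := by
  have : lyap Λ = fun ξ : State N => lyap Λ ξ := rfl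
  rw [this]
  simp only [lyap_eq, constForm, dotProduct, mulVec, zPart, tau, vtilde]
  fun_prop

theorem add_smul_dotProduct_mulVec {n : Type*} [Fintype n] {A : Matrix n n ℝ} (hA : A.IsHermitian)
    (x y : n → ℝ) (r : ℝ) : (x + r • y) ⬝ᵥ A *ᵥ (x + r • y) =
      x ⬝ᵥ A *ᵥ x + r * (2 * (x ⬝ᵥ A *ᵥ y)) + r ^ 2 * (y ⬝ᵥ A *ᵥ y) := by
  have hsymm := dotProduct_mulVec_comm hA y x
  simp only [mulVec_add, mulVec_smul, dotProduct_add, add_dotProduct,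
    dotProduct_smul, smul_dotProduct, smul_eq_mul, hsymm]
  ring

theorem constForm_add_smul (x y : ZIdx N → ℝ) (r : ℝ) :
    constForm Λ (x + r • y) (x + r • y) =
      constForm Λ x x + r * (2 * constForm Λ x y) + r ^ 2 * constForm Λ y y := by
  have h1 := add_smul_dotProduct_mulVec Λ.P₁_posDef.1 (fun i => x (Sum.inl i))
    (fun i => y (Sum.inl i)) r
  have h3 := add_smul_dotProduct_mulVec Λ.P₃_posDef.1 (fun i => x (Sum.inr (Sum.inr i)))
    (fun i => y (Sum.inr (Sum.inr i))) r
  have h : constForm Λ (x + r • y) (x + r • y) = _ := congrArg₂ (· + ·) h1 h3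
  rw [h, constForm, constForm, constForm]
  ring

theorem hasDerivAt_lyap (ξ v : State N) : HasDerivAt (fun r : ℝ => lyap Λ (ξ + r • v))
    (2 * ((zPart ξ).ofLp ⬝ᵥ PMat Λ (tau ξ) *ᵥ (zPart v).ofLp) +
      ∑ p, Λ.p₂ p * Real.exp (Λ.σ * tau ξ p) * (Λ.σ * tau v p) * (vtilde ξ p * vtilde ξ p)) 0 := by
  have h1 : ∀ r : ℝ, lyap Λ (ξ + r • v) =
      (constForm Λ (zPart ξ).ofLp (zPart ξ).ofLp +
        r * (2 * constForm Λ (zPart ξ).ofLp (zPart v).ofLp) +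
        r ^ 2 * constForm Λ (zPart v).ofLp (zPart v).ofLp) +
      ∑ p, Λ.p₂ p * Real.exp (Λ.σ * (tau ξ p + r * tau v p)) *
        ((vtilde ξ p + r * vtilde v p) * (vtilde ξ p + r * vtilde v p)) := by
    intro r
    rw [lyap_eq, ← constForm_add_smul]
    rfl
  simp only [h1]
  have hlin : ∀ a b : ℝ, HasDerivAt (fun r : ℝ => a + r * b) b 0 := fun a b => by
    simpa using ((hasDerivAt_id (0 : ℝ)).mul_const b).const_add a
  have hc : HasDerivAt (fun r : ℝ => constForm Λ (zPart ξ).ofLp (zPart ξ).ofLp +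
        r * (2 * constForm Λ (zPart ξ).ofLp (zPart v).ofLp) +
        r ^ 2 * constForm Λ (zPart v).ofLp (zPart v).ofLp)
        (2 * constForm Λ (zPart ξ).ofLp (zPart v).ofLp) 0 := by
    simpa using (hlin _ _).fun_add ((hasDerivAt_pow 2 (0 : ℝ)).mul_const
      (constForm Λ (zPart v).ofLp (zPart v).ofLp))
  have hs := HasDerivAt.fun_sum (u := Finset.univ) (fun p _ =>
    ((((hlin (tau ξ p) (tau v p)).const_mul Λ.σ).exp.const_mul (Λ.p₂ p)).fun_mul
      ((hlin (vtilde ξ p) (vtilde v p)).fun_mul (hlin (vtilde ξ p) (vtilde v p)))))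
  refine (hc.add hs).congr_deriv ?_
  have h2 : ∀ p, (zPart ξ).ofLp (Sum.inr (Sum.inl p)) = vtilde ξ p := fun p => rfl
  have h3 : ∀ p, (zPart v).ofLp (Sum.inr (Sum.inl p)) = vtilde v p := fun p => rfl
  rw [dotProduct_PMat_mulVec, mul_add, add_assoc, Finset.mul_sum, ← Finset.sum_add_distrib]
  congr 1
  refine Finset.sum_congr rfl fun p _ => ?_
  simp only [h2, h3, zero_mul, add_zero]
  ring

theorem lyap_le_alpha2 {ξ : State N} (hξ : ξ ∈ flowSet S) :
    lyap Λ ξ ≤ alpha2 S Λ * ‖zPart ξ‖ ^ 2 := by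
  rw [← dotProduct_self_eq_norm_sq]
  exact (dotProduct_PMat_mulVec_mono (fun p => (hξ p).2) _).trans
    (dotProduct_mulVec_le_lamMax (PMat_posDef Λ S.T₂).1 _)

theorem alpha1_le_lyap {ξ : State N} (hξ : ξ ∈ flowSet S) :
    alpha1 Λ * ‖zPart ξ‖ ^ 2 ≤ lyap Λ ξ := by
  rw [← dotProduct_self_eq_norm_sq]
  exact (lamMin_le_dotProduct_mulVec (PMat_posDef Λ 0).1 _).trans
    (dotProduct_PMat_mulVec_mono (fun p => (hξ p).1) _)

theorem dotProduct_PMat_mulVec_le_specNorm {τ : Fin N → ℝ} (hτ : τ ∈ timerBox S)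
    (x : EuclideanSpace ℝ (ZIdx N)) :
    x.ofLp ⬝ᵥ PMat Λ τ *ᵥ x.ofLp ≤ specNorm (PMat Λ S.T₂) * ‖x‖ ^ 2 := by
  rw [← dotProduct_self_eq_norm_sq]
  exact (dotProduct_PMat_mulVec_mono (fun p => (hτ p).2) _).trans
    (dotProduct_mulVec_le_specNorm _ _)

/-- The ultimate bound `c` of the Lyapunov function, chosen so that `μ̄ c` is the contribution
`‖P(T₂)‖ δ_max² / κ` of the disturbances to its derivative. -/
noncomputable def lyapOffset (S : Network N) (V : Matrix (Fin N) (Fin (N - 1)) ℝ)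
    (D : Matrix (Fin (N - 1)) (Fin (N - 1)) ℝ) (Λ : LyapunovData N) (κ : ℝ) : ℝ :=
  specNorm (PMat Λ S.T₂) * deltaMax S V ^ 2 / (κ * muBar S V D Λ κ)

/-- The dissipation inequality `V' ≤ -μ̄ (V - c)` along flows. -/
theorem lyap_deriv_le [Nonempty (ZIdx N)] (hM : ∀ τ ∈ timerBox S, (-MMat S V D Λ τ).PosDef) {κ : ℝ}
    (hκ : 0 < κ) (hμ : 0 < muBar S V D Λ κ) {ξ v : State N} (hξ : ξ ∈ flowSet S)
    (hv : v ∈ flowMap S V D ξ) :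
    2 * ((zPart ξ).ofLp ⬝ᵥ PMat Λ (tau ξ) *ᵥ (zPart v).ofLp) +
      ∑ p, Λ.p₂ p * Real.exp (Λ.σ * tau ξ p) * (Λ.σ * tau v p) * (vtilde ξ p * vtilde ξ p) ≤
    -muBar S V D Λ κ * (lyap Λ ξ - lyapOffset S V D Λ κ) := by
  have hα2 : 0 < alpha2 S Λ := lamMax_pos (PMat_posDef Λ _)
  have hnorm : 0 < specNorm (PMat Λ S.T₂) := specNorm_pos (PMat_posDef Λ _)
  obtain ⟨⟨w, hw, hzv⟩, -⟩ := id hv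
  set x := (zPart ξ).ofLp with hx
  have hzv' : (zPart v).ofLp = flowMatrix S V D *ᵥ x + w.ofLp := by rw [hzv]; rfl
  -- the timers decrease at least at rate `bMin`
  have h1 : ∑ p, Λ.p₂ p * Real.exp (Λ.σ * tau ξ p) * (Λ.σ * tau v p) * (vtilde ξ p * vtilde ξ p) ≤
      x ⬝ᵥ QMat S Λ (tau ξ) *ᵥ x := by
    rw [dotProduct_QMat_mulVec, Finset.mul_sum]
    refine Finset.sum_le_sum fun p _ => ?_
    have h2 : tau v p ≤ -bMin S := by
      linarith [(tau_of_mem_flowMap hv p).2, bMin_le S p]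
    have h3 : 0 ≤ Λ.p₂ p * Real.exp (Λ.σ * tau ξ p) * (vtilde ξ p * vtilde ξ p) :=
      mul_nonneg (mul_pos (Λ.p₂_pos p) (Real.exp_pos _)).le (mul_self_nonneg _)
    have h4 := mul_le_mul_of_nonneg_left (mul_le_mul_of_nonneg_left h2 Λ.σ_pos.le) h3
    have h5 : x (Sum.inr (Sum.inl p)) = vtilde ξ p := rfl
    rw [h5]
    linarith
  have h2 := (mu_pos_and_dotProduct_MMat_mulVec_le hM).2 (tau ξ) hξ x
  rw [dotProduct_MMat_mulVec] at h2
  have h3 := two_mul_dotProduct_mulVec_le (PMat_posDef Λ (tau ξ)).posSemidef hκ x w.ofLp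
  have h4 := dotProduct_PMat_mulVec_le_specNorm (Λ := Λ) hξ (zPart ξ)
  have h5 := dotProduct_PMat_mulVec_le_specNorm (Λ := Λ) hξ w
  have h6 : ‖w‖ ^ 2 ≤ deltaMax S V ^ 2 :=
    pow_le_pow_left₀ (norm_nonneg _) (norm_le_deltaMax hw) 2
  have h7 : muBar S V D Λ κ * lyap Λ ξ ≤
      (mu S V D Λ - κ * specNorm (PMat Λ S.T₂)) * ‖zPart ξ‖ ^ 2 := by
    have := mul_le_mul_of_nonneg_left (lyap_le_alpha2 (Λ := Λ) hξ) hμ.le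
    refine this.trans_eq ?_
    rw [muBar]
    field_simp
  have h8 : muBar S V D Λ κ * lyapOffset S V D Λ κ =
      1 / κ * (specNorm (PMat Λ S.T₂) * deltaMax S V ^ 2) := by
    rw [lyapOffset]
    field_simp
  have h9 : 1 / κ * (w.ofLp ⬝ᵥ PMat Λ (tau ξ) *ᵥ w.ofLp) ≤
      1 / κ * (specNorm (PMat Λ S.T₂) * deltaMax S V ^ 2) :=
    mul_le_mul_of_nonneg_left (h5.trans (mul_le_mul_of_nonneg_left h6 hnorm.le)) (by positivity)
  have h10 := mul_le_mul_of_nonneg_left h4 hκ.le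
  rw [hzv', mulVec_add, dotProduct_add]
  have hxx : x ⬝ᵥ x = ‖zPart ξ‖ ^ 2 := dotProduct_self_eq_norm_sq _
  rw [hxx] at h2
  rw [← hx] at h10
  nlinarith

/-- Jumps do not increase the Lyapunov function. -/
theorem lyap_jump_le {ξ g : State N} (hg : g ∈ jumpMap S ξ) : lyap Λ g ≤ lyap Λ ξ := by
  obtain ⟨p, -, h1, h2, h3, h4, -, h5⟩ := hg
  rw [lyap_eq, lyap_eq]
  have hc : constForm Λ (zPart g).ofLp (zPart g).ofLp =
      constForm Λ (zPart ξ).ofLp (zPart ξ).ofLp := by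
    have e1 : (fun i => (zPart g).ofLp (Sum.inl i)) = fun i => (zPart ξ).ofLp (Sum.inl i) := h1
    have e2 : (fun i => (zPart g).ofLp (Sum.inr (Sum.inr i))) =
        fun i => (zPart ξ).ofLp (Sum.inr (Sum.inr i)) := by
      funext i
      rcases i with i | i
      · exact congrFun h3 i
      · exact congrFun h4 i
    rw [constForm, constForm, e1, e2]
  rw [hc]
  refine add_le_add_right (Finset.sum_le_sum fun q _ => ?_) _
  rw [h2]
  by_cases hq : q = p
  · subst hq
    simp only [Function.update_self, mul_zero]
    exact mul_nonneg (mul_pos (Λ.p₂_pos q) (Real.exp_pos _)).le (mul_self_nonneg _)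
  · rw [Function.update_of_ne hq, h5 q hq]

/-! ### Estimates along solutions -/

variable {φ : HybridSignal (State N)}

theorem mem_flowSet_of_isSolution (hφ : HybridSignal.IsSolution (closedLoop S V D) φ) {t : ℝ}
    {j : ℕ} (h : (t, j) ∈ φ.dom) : φ.val t j ∈ flowSet S :=
  hφ.mem_flowSet (isClosed_flowSet S) (jumpSet_subset_flowSet S)
    (fun ξ _ => jumpMap_subset_flowSet ξ) h

theorem hasDerivAt_tau_add_mul (p : Fin N) (t k : ℝ) (ξ v : State N) :
    HasDerivAt (fun r : ℝ => tau (ξ + r • v) p + k * (t + r)) (tau v p + k) 0 := by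
  have h : ∀ r : ℝ, tau (ξ + r • v) p + k * (t + r) = tau ξ p + r * tau v p + k * (t + r) :=
    fun r => rfl
  simp only [h]
  have h1 := ((hasDerivAt_id (0 : ℝ)).mul_const (tau v p)).const_add (tau ξ p)
  have h2 := ((hasDerivAt_id (0 : ℝ)).const_add t).const_mul k
  simpa using h1.fun_add h2

theorem tau_le_of_flow (hφ : HybridSignal.IsSolution (closedLoop S V D) φ) {s t : ℝ} {j : ℕ}
    (hst : s ≤ t) (hI : Icc s t ⊆ φ.flowTimes j) (p : Fin N) :
    tau (φ.val t j) p ≤ tau (φ.val s j) p - (S.b p - S.δ p) * (t - s) := by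
  have := hφ.antitone_of_flow
    (U := fun q : ℝ × State N => tau q.2 p + (S.b p - S.δ p) * q.1)
    (by unfold tau; fun_prop)
    (fun t ξ _ v hv => ⟨_, by linarith [(tau_of_mem_flowMap hv p).2],
      hasDerivAt_tau_add_mul p t _ ξ v⟩) hst hI
  simp only at this
  linarith

theorem le_tau_of_flow (hφ : HybridSignal.IsSolution (closedLoop S V D) φ) {s t : ℝ} {j : ℕ}
    (hst : s ≤ t) (hI : Icc s t ⊆ φ.flowTimes j) (p : Fin N) :
    tau (φ.val s j) p - (S.b p + S.δ p) * (t - s) ≤ tau (φ.val t j) p := by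
  have := hφ.antitone_of_flow
    (U := fun q : ℝ × State N => -(tau q.2 p + (S.b p + S.δ p) * q.1))
    (by unfold tau; fun_prop)
    (fun t ξ _ v hv => ⟨_, by linarith [(tau_of_mem_flowMap hv p).1],
      (hasDerivAt_tau_add_mul p t _ ξ v).neg⟩) hst hI
  simp only at this
  linarith

/-- Flows stop at the jump set: an expired timer would become negative. -/
theorem flow_ends_of_mem_jumpSet (hφ : HybridSignal.IsSolution (closedLoop S V D) φ) {t s : ℝ}
    {j : ℕ} (ht : (t, j) ∈ φ.dom) (hD : φ.val t j ∈ jumpSet S) (hs : (s, j) ∈ φ.dom) : s ≤ t := by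
  by_contra! hts
  obtain ⟨p, -, hp⟩ := mem_iUnion.1 hD
  have h1 := tau_le_of_flow hφ hts.le (fun r hr => hφ.isArc.isDomain.ordConnected ht hs hr) p
  have h2 := (mem_flowSet_of_isSolution hφ hs p).1
  nlinarith [S.δ_lt_b p]

/-- The exponential decay of the Lyapunov function in ordinary time. -/
theorem lyap_le_exp [Nonempty (ZIdx N)] (hM : ∀ τ ∈ timerBox S, (-MMat S V D Λ τ).PosDef) {κ : ℝ}
    (hκ : 0 < κ) (hμ : 0 < muBar S V D Λ κ)
    (hφ : HybridSignal.IsSolution (closedLoop S V D) φ) {t : ℝ} {j : ℕ} (h : (t, j) ∈ φ.dom) :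
    lyap Λ (φ.val t j) ≤
      Real.exp (-(muBar S V D Λ κ * t)) * lyap Λ (φ.val 0 0) + lyapOffset S V D Λ κ := by
  set m := muBar S V D Λ κ with hm
  set c := lyapOffset S V D Λ κ with hc
  have hc0 : 0 ≤ c := by
    rw [hc, lyapOffset]
    have := (specNorm_pos (PMat_posDef Λ S.T₂)).le
    have := mul_pos hκ hμ
    positivity
  -- `exp (μ̄ t) (V - c)` does not increase
  have key : Real.exp (m * t) * (lyap Λ (φ.val t j) - c) ≤ lyap Λ (φ.val 0 0) - c := by
    refine hφ.isArc.isDomain.induction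
      (P := fun t j => Real.exp (m * t) * (lyap Λ (φ.val t j) - c) ≤ lyap Λ (φ.val 0 0) - c)
      (by simp) ?_ ?_ h
    · intro j s t hst hI hs
      refine le_trans ?_ hs
      refine hφ.antitone_of_flow (U := fun q : ℝ × State N => Real.exp (m * q.1) * (lyap Λ q.2 - c))
        ?_ ?_ hst hI
      · have := (contDiff_lyap Λ).comp (contDiff_snd (𝕜 := ℝ) (E := ℝ) (F := State N))
        exact (by fun_prop : ContDiff ℝ 1 fun q : ℝ × State N => Real.exp (m * q.1)).mul
          (this.sub contDiff_const)
      · intro t ξ hξ v hv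
        have h1 := lyap_deriv_le hM hκ hμ hξ hv
        have h2 := (((hasDerivAt_id (0 : ℝ)).const_add t).const_mul m).exp
        have h3 := h2.fun_mul ((hasDerivAt_lyap (Λ := Λ) ξ v).sub_const c)
        refine ⟨_, ?_, h3⟩
        simp only [id, add_zero, zero_smul, mul_one]
        rw [← hm, ← hc] at h1
        have h4 := Real.exp_pos (m * t)
        nlinarith
    · intro t j h1 h2 ht
      refine le_trans ?_ ht
      have := lyap_jump_le (Λ := Λ) (hφ.jump t j h1 h2).2
      gcongr
  have h1 : lyap Λ (φ.val t j) - c ≤ Real.exp (-(m * t)) * (lyap Λ (φ.val 0 0) - c) := by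
    have := mul_le_mul_of_nonneg_left key (Real.exp_pos (-(m * t))).le
    rwa [← mul_assoc, ← Real.exp_add, neg_add_cancel, Real.exp_zero, one_mul] at this
  nlinarith [Real.exp_pos (-(m * t))]

/-- The number of jumps grows at most linearly in ordinary time. Each jump raises the potential
`∑ min (τ_p / T₁ p) 1`, which takes values in `[0, N]`, by at least one, and flows lower it at rate
at most `N / h`. -/
theorem jumps_le {h : ℝ} (hN : 0 < N) (hh : h ∈ Ioc 0 (TMin S / bMax S))
    (hφ : HybridSignal.IsSolution (closedLoop S V D) φ) {t : ℝ} {j : ℕ} (htj : (t, j) ∈ φ.dom) :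
    (j : ℝ) ≤ N + N * (t / h) := by
  have : Nonempty (Fin N) := ⟨⟨0, hN⟩⟩
  have hrate : ∀ p, (S.b p + S.δ p) / S.T₁ p ≤ 1 / h := by
    intro p
    rw [div_le_div_iff₀ (S.T₁_pos p) hh.1]
    have h1 := (le_div_iff₀ (bMax_pos S)).1 hh.2
    have h2 := mul_le_mul_of_nonneg_right (le_bMax S p) hh.1.le
    linarith [TMin_le S p]
  have key : (j : ℝ) ≤ ∑ p, min (tau (φ.val t j) p / S.T₁ p) 1 + N * (t / h) := by
    refine hφ.isArc.isDomain.induction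
      (P := fun t j => (j : ℝ) ≤ ∑ p, min (tau (φ.val t j) p / S.T₁ p) 1 + N * (t / h)) ?_ ?_ ?_ htj
    · have h0 := mem_flowSet_of_isSolution hφ hφ.isArc.zero_mem
      simp only [Nat.cast_zero, zero_div, mul_zero, add_zero]
      exact Finset.sum_nonneg fun p _ =>
        le_min (div_nonneg (h0 p).1 (S.T₁_pos p).le) zero_le_one
    · intro j s t hst hI hs
      have h1 : ∑ p, min (tau (φ.val s j) p / S.T₁ p) 1 - N * ((t - s) / h) ≤
          ∑ p, min (tau (φ.val t j) p / S.T₁ p) 1 := by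
        have : (N : ℝ) * ((t - s) / h) = ∑ _p : Fin N, (t - s) / h := by simp
        rw [this, ← Finset.sum_sub_distrib]
        refine Finset.sum_le_sum fun p _ => le_min ?_ ?_
        · have h2 := div_le_div_of_nonneg_right (le_tau_of_flow hφ hst hI p) (S.T₁_pos p).le
          have h3 := mul_le_mul_of_nonneg_right (hrate p) (sub_nonneg.2 hst)
          have h4 : (tau (φ.val s j) p - (S.b p + S.δ p) * (t - s)) / S.T₁ p =
            tau (φ.val s j) p / S.T₁ p - (S.b p + S.δ p) / S.T₁ p * (t - s) := by ring
          have h5 : 1 / h * (t - s) = (t - s) / h := by ring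
          linarith [min_le_left (tau (φ.val s j) p / S.T₁ p) 1]
        · have : 0 ≤ (t - s) / h := div_nonneg (sub_nonneg.2 hst) hh.1.le
          linarith [min_le_right (tau (φ.val s j) p / S.T₁ p) 1]
      have h2 : (N : ℝ) * ((t - s) / h) = N * (t / h) - N * (s / h) := by ring
      linarith
    · intro t j h1 h2 ht
      obtain ⟨p, ⟨-, hp0⟩, -, -, -, -, hp, hq⟩ := (hφ.jump t j h1 h2).2
      have h3 : ∑ q, min (tau (φ.val t j) q / S.T₁ q) 1 + 1 ≤
          ∑ q, min (tau (φ.val t (j + 1)) q / S.T₁ q) 1 := by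
        rw [← Finset.add_sum_erase _ _ (Finset.mem_univ p),
          ← Finset.add_sum_erase _ (fun q => min (tau (φ.val t (j + 1)) q / S.T₁ q) 1)
            (Finset.mem_univ p)]
        have h4 : min (tau (φ.val t (j + 1)) p / S.T₁ p) 1 = 1 :=
          min_eq_right ((one_le_div (S.T₁_pos p)).2 hp.1)
        have h5 : min (tau (φ.val t j) p / S.T₁ p) 1 = 0 := by
          rw [hp0, zero_div]; exact min_eq_left zero_le_one
        have h6 : ∑ q ∈ Finset.univ.erase p, min (tau (φ.val t j) q / S.T₁ q) 1 =
            ∑ q ∈ Finset.univ.erase p, min (tau (φ.val t (j + 1)) q / S.T₁ q) 1 :=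
          Finset.sum_congr rfl fun q hq' => by rw [hq q (Finset.ne_of_mem_erase hq')]
        rw [h4, h5, h6]
        linarith
      push_cast
      linarith
  have h1 : ∑ p, min (tau (φ.val t j) p / S.T₁ p) 1 ≤ ∑ _p : Fin N, (1 : ℝ) :=
    Finset.sum_le_sum fun p _ => min_le_right _ _
  simp only [Finset.sum_const, Finset.card_univ, Fintype.card_fin, nsmul_eq_mul, mul_one] at h1
  linarith

/-! ### The constants of the exponential bound -/

theorem alpha1_pos [Nonempty (ZIdx N)] (Λ : LyapunovData N) : 0 < alpha1 Λ :=
  lamMin_pos (PMat_posDef Λ 0)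

theorem alpha2_pos [Nonempty (ZIdx N)] (S : Network N) (Λ : LyapunovData N) : 0 < alpha2 S Λ :=
  lamMax_pos (PMat_posDef Λ _)

theorem muBar_pos [Nonempty (ZIdx N)] {κ : ℝ}
    (hκ : κ ∈ Ioo 0 (mu S V D Λ / specNorm (PMat Λ S.T₂))) : 0 < muBar S V D Λ κ := by
  have := (lt_div_iff₀ (specNorm_pos (PMat_posDef Λ S.T₂))).1 hκ.2
  exact div_pos (by linarith) (alpha2_pos S Λ)

theorem kappa1_pos [Nonempty (ZIdx N)] (κ ε h : ℝ) : 0 < kappa1 S V D Λ κ ε h :=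
  Real.sqrt_pos.2 (mul_pos (div_pos (alpha2_pos S Λ) (alpha1_pos Λ)) (Real.exp_pos _))

theorem kappa2_nonneg (κ : ℝ) : 0 ≤ kappa2 S V D Λ κ :=
  mul_nonneg (Real.sqrt_nonneg _) (deltaMax_nonneg S V)

theorem kappa2_pos [Nonempty (ZIdx N)] {κ : ℝ} (hκ : 0 < κ) (hμ : 0 < muBar S V D Λ κ)
    (hδ : ∃ p, 0 < S.δ p) : 0 < kappa2 S V D Λ κ :=
  mul_pos (Real.sqrt_pos.2 (div_pos (specNorm_pos (PMat_posDef Λ _))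
    (mul_pos (mul_pos (alpha1_pos Λ) hμ) hκ))) (deltaMax_pos hδ)

theorem rate_pos {κ ε h : ℝ} (hN : 0 < N) (hμ : 0 < muBar S V D Λ κ) (hε : ε ∈ Ioo (0 : ℝ) 1)
    (hh : 0 < h) : 0 < rate S V D Λ κ ε h := by
  have h1 : 0 < 1 - ε := by linarith [hε.2]
  have h2 := hε.1
  have h3 : (0 : ℝ) < N := by exact_mod_cast hN
  unfold rate
  positivity

/-- The exponential bound on `z` in hybrid time. -/
theorem norm_zPart_le_exp [Nonempty (ZIdx N)] (hN : 0 < N)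
    (hM : ∀ τ ∈ timerBox S, (-MMat S V D Λ τ).PosDef) {κ ε h : ℝ} (hκ : 0 < κ)
    (hμ : 0 < muBar S V D Λ κ) (hε : ε ∈ Ioo (0 : ℝ) 1) (hh : h ∈ Ioc 0 (TMin S / bMax S))
    (hφ : HybridSignal.IsSolution (closedLoop S V D) φ) {t : ℝ} {j : ℕ} (htj : (t, j) ∈ φ.dom) :
    ‖zPart (φ.val t j)‖ ≤ kappa1 S V D Λ κ ε h * Real.exp (-rate S V D Λ κ ε h * (t + j)) *
      ‖zPart (φ.val 0 0)‖ + kappa2 S V D Λ κ := by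
  have hα1 := alpha1_pos Λ
  have hα2 := alpha2_pos S Λ
  have hp := specNorm_pos (PMat_posDef Λ S.T₂)
  have ht0 := hφ.isArc.isDomain.1 _ htj
  have hN' : (0 : ℝ) < N := by exact_mod_cast hN
  have h1ε : 0 < 1 - ε := by linarith [hε.2]
  set m := muBar S V D Λ κ with hm
  set α := rate S V D Λ κ ε h with hα
  set r := ‖zPart (φ.val 0 0)‖ with hr
  have h1 := alpha1_le_lyap (Λ := Λ) (mem_flowSet_of_isSolution hφ htj)
  have h2 := lyap_le_exp hM hκ hμ hφ htj
  have h3 := lyap_le_alpha2 (Λ := Λ) (mem_flowSet_of_isSolution hφ hφ.isArc.zero_mem)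
  -- the exponents, by splitting `t = ε t + (1 - ε) t` and counting jumps
  have hexp : -(m * t) ≤ m * (1 - ε) * h + 2 * (-α * (t + j)) := by
    have e1 : 2 * α ≤ m * ε := by
      have := min_le_left (m * ε) (m * (1 - ε) * h / N)
      rw [hα, rate]; linarith
    have e2 : 2 * α ≤ m * (1 - ε) * h / N := by
      have := min_le_right (m * ε) (m * (1 - ε) * h / N)
      rw [hα, rate]; linarith
    have e3 := mul_le_mul_of_nonneg_right e1 ht0
    have e4 := mul_le_mul_of_nonneg_right e2 (Nat.cast_nonneg (α := ℝ) j)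
    have e5 : m * (1 - ε) * h / N * j ≤ m * (1 - ε) * h / N * (N + N * (t / h)) :=
      mul_le_mul_of_nonneg_left (jumps_le hN hh hφ htj) (by have := hh.1; positivity)
    have e6 : m * (1 - ε) * h / N * (N + N * (t / h)) = m * (1 - ε) * h + m * (1 - ε) * t := by
      have := hh.1.ne'
      field_simp
    simp only at e3
    linarith
  have hA : (kappa1 S V D Λ κ ε h * Real.exp (-α * (t + j)) * r) ^ 2 =
      alpha2 S Λ / alpha1 Λ * Real.exp (m * (1 - ε) * h + 2 * (-α * (t + j))) * r ^ 2 := by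
    rw [mul_pow, mul_pow, kappa1, Real.sq_sqrt (by positivity), ← Real.exp_nat_mul, Real.exp_add]
    push_cast
    ring
  have hB : kappa2 S V D Λ κ ^ 2 = lyapOffset S V D Λ κ / alpha1 Λ := by
    rw [kappa2, mul_pow, Real.sq_sqrt (by positivity), lyapOffset, ← hm]
    field_simp
  have hz : ‖zPart (φ.val t j)‖ ^ 2 ≤
      (kappa1 S V D Λ κ ε h * Real.exp (-α * (t + j)) * r) ^ 2 + kappa2 S V D Λ κ ^ 2 := by
    rw [hA, hB]
    have h4 : alpha1 Λ * ‖zPart (φ.val t j)‖ ^ 2 ≤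
        Real.exp (m * (1 - ε) * h + 2 * (-α * (t + j))) * (alpha2 S Λ * r ^ 2) +
          lyapOffset S V D Λ κ := by
      refine h1.trans (h2.trans (add_le_add_left ?_ _))
      exact mul_le_mul (Real.exp_le_exp.2 hexp) h3
        ((by positivity : 0 ≤ alpha1 Λ * r ^ 2).trans
          (alpha1_le_lyap (mem_flowSet_of_isSolution hφ hφ.isArc.zero_mem))) (Real.exp_pos _).le
    have h5 : ‖zPart (φ.val t j)‖ ^ 2 ≤
        (Real.exp (m * (1 - ε) * h + 2 * (-α * (t + j))) * (alpha2 S Λ * r ^ 2) +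
          lyapOffset S V D Λ κ) / alpha1 Λ := by
      rw [le_div_iff₀ hα1]; linarith
    refine h5.trans_eq ?_
    field_simp
  have hA0 : 0 ≤ kappa1 S V D Λ κ ε h * Real.exp (-α * (t + j)) * r :=
    mul_nonneg (mul_nonneg (kappa1_pos κ ε h).le (Real.exp_pos _).le) (norm_nonneg _)
  have hB0 : 0 ≤ kappa2 S V D Λ κ := kappa2_nonneg κ
  refine le_of_sq_le_sq (hz.trans ?_) (add_nonneg hA0 hB0)
  nlinarith [mul_nonneg hA0 hB0]

/-- The exponential bound for one admissible choice of `κ`, `ε`, `h`, with offsets that make the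
constants positive even when the solution starts in the attractor or there are no disturbances. -/
theorem exists_norm_zPart_le [Nonempty (ZIdx N)] (hN : 0 < N)
    (hM : ∀ τ ∈ timerBox S, (-MMat S V D Λ τ).PosDef)
    (hφ : HybridSignal.IsSolution (closedLoop S V D) φ) :
    ∃ α κ₁ κ₂ : ℝ, 0 < α ∧ 0 < κ₁ ∧ 0 < κ₂ ∧ ∀ t j, (t, j) ∈ φ.dom →
      ‖zPart (φ.val t j)‖ ≤ κ₁ * Real.exp (-α * (t + j)) + κ₂ := by
  have : Nonempty (Fin N) := ⟨⟨0, hN⟩⟩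
  have hμ0 := (mu_pos_and_dotProduct_MMat_mulVec_le hM).1
  have hq : 0 < mu S V D Λ / specNorm (PMat Λ S.T₂) :=
    div_pos hμ0 (specNorm_pos (PMat_posDef Λ _))
  set κ := mu S V D Λ / specNorm (PMat Λ S.T₂) / 2 with hκ
  have hκ' : κ ∈ Ioo 0 (mu S V D Λ / specNorm (PMat Λ S.T₂)) := ⟨by positivity, by linarith⟩
  have hμ := muBar_pos hκ'
  have hε : (1 / 2 : ℝ) ∈ Ioo (0 : ℝ) 1 := by norm_num
  have hh : TMin S / bMax S ∈ Ioc 0 (TMin S / bMax S) :=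
    ⟨div_pos (TMin_pos S) (bMax_pos S), le_rfl⟩
  refine ⟨rate S V D Λ κ (1 / 2) (TMin S / bMax S),
    kappa1 S V D Λ κ (1 / 2) (TMin S / bMax S) * ‖zPart (φ.val 0 0)‖ + 1,
    kappa2 S V D Λ κ + 1, rate_pos hN hμ hε hh.1,
    by have := kappa1_pos (S := S) (V := V) (D := D) (Λ := Λ) κ (1 / 2) (TMin S / bMax S); positivity,
    by linarith [kappa2_nonneg (S := S) (V := V) (D := D) (Λ := Λ) κ], fun t j h => ?_⟩
  have h1 := norm_zPart_le_exp hN hM hκ'.1 hμ hε hh hφ h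
  have h2 := Real.exp_pos (-rate S V D Λ κ (1 / 2) (TMin S / bMax S) * (t + j))
  nlinarith

/-! ### Completeness of maximal solutions -/

/-- From a state with no expired timer the disturbance-free flow stays in the flow set for a short
time. -/
theorem exists_flow_of_notMem_jumpSet {ξ : State N} (hξ : ξ ∈ flowSet S) (hD : ξ ∉ jumpSet S) :
    ∃ ε > 0, ∃ f : ℝ → State N, f 0 = ξ ∧ (∃ K, LipschitzOnWith K f (Icc 0 ε)) ∧
      ∀ t ∈ Ioo 0 ε, f t ∈ flowSet S ∧ ∃ v ∈ flowMap S V D (f t), HasDerivAt f v t := by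
  have hpos : ∀ p, 0 < tau ξ p := fun p => lt_of_le_of_ne (hξ p).1 fun h =>
    hD (mem_iUnion.2 ⟨p, hξ, h.symm⟩)
  obtain ⟨ε, hε0, hε⟩ : ∃ ε > 0, ∀ p, S.b p * ε < tau ξ p := by
    have h1 : ∀ᶠ r in nhdsWithin (0 : ℝ) (Ioi 0), ∀ p, S.b p * r < tau ξ p := by
      rw [Filter.eventually_all]
      intro p
      have : Continuous fun r : ℝ => S.b p * r := by fun_prop
      exact (this.continuousAt.eventually_lt_const (by simpa using hpos p)).filter_mono
        nhdsWithin_le_nhds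
    obtain ⟨r, hr, hr0⟩ := (h1.and self_mem_nhdsWithin).exists
    exact ⟨r, hr0, hr⟩
  have hb : ∀ p, 0 < S.b p := fun p => (S.δ_nonneg p).trans_lt (S.δ_lt_b p)
  set A := toEuclideanCLM (𝕜 := ℝ) (flowMatrix S V D) with hA
  set ζ : ℝ → EuclideanSpace ℝ (ZIdx N) := fun t => NormedSpace.exp (t • A) (zPart ξ) with hζ
  have hζd : ∀ t, HasDerivAt ζ (A (ζ t)) t := by
    intro t
    have h1 := (hasDerivAt_exp_smul_const' A t)
    have h2 := (ContinuousLinearMap.apply ℝ _ (zPart ξ)).hasFDerivAt.comp_hasDerivAt t h1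
    exact h2
  set f : ℝ → State N := fun t =>
    WithLp.toLp 2 (Sum.elim (ζ t).ofLp (fun p => tau ξ p - t * S.b p)) with hf
  set f' : ℝ → State N := fun t =>
    WithLp.toLp 2 (Sum.elim (A (ζ t)).ofLp (fun p => -S.b p)) with hf'
  have hfd : ∀ t, HasDerivAt f (f' t) t := by
    intro t
    have hp : HasDerivAt (fun t => Sum.elim (ζ t).ofLp (fun p => tau ξ p - t * S.b p))
        (Sum.elim (A (ζ t)).ofLp (fun p => -S.b p)) t := by
      refine hasDerivAt_pi.2 ?_
      rintro (i | p)
      · exact (PiLp.hasFDerivAt_apply 2 (ζ t) i).comp_hasDerivAt t (hζd t)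
      · simpa using ((hasDerivAt_id t).mul_const (S.b p)).const_sub (tau ξ p)
    exact HasFDerivAt.comp_hasDerivAt t
      (PiLp.hasFDerivAt_toLp 2 (𝕜 := ℝ) (E := fun _ : ZIdx N ⊕ Fin N => ℝ) _) hp
  have hf'c : Continuous f' := by
    have hζc : Continuous ζ := continuous_iff_continuousAt.2 fun t => (hζd t).continuousAt
    rw [hf']
    refine (PiLp.continuous_toLp 2 _).comp (continuous_pi ?_)
    rintro (i | p)
    · exact (by fun_prop : Continuous fun t => (A (ζ t)).ofLp i)
    · exact continuous_const
  have hf0 : f 0 = ξ := by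
    have hζ0 : ζ 0 = zPart ξ := by
      have h0 : (0 : ℝ) • A = 0 := zero_smul ℝ A
      change NormedSpace.exp ((0 : ℝ) • A) (zPart ξ) = zPart ξ
      rw [h0, NormedSpace.exp_zero]
      rfl
    ext i
    rcases i with i | p
    · exact congrArg (fun x : EuclideanSpace ℝ (ZIdx N) => x i) hζ0
    · simp [hf, tau]
  refine ⟨ε, hε0, f, hf0, ?_, fun t ht => ⟨fun p => ?_, f' t, ?_, hfd t⟩⟩
  · have hC1 : ContDiff ℝ 1 f := by
      rw [contDiff_one_iff_deriv]
      refine ⟨fun t => (hfd t).differentiableAt, ?_⟩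
      rwa [show deriv f = f' from funext fun t => (hfd t).deriv]
    exact hC1.contDiffOn.exists_lipschitzOnWith one_ne_zero (convex_Icc 0 ε) isCompact_Icc
  · have h1 : tau (f t) p = tau ξ p - t * S.b p := rfl
    rw [h1]
    have h2 := mul_lt_mul_of_pos_right ht.2 (hb p)
    have h3 := mul_pos ht.1 (hb p)
    exact ⟨by linarith [hε p], by linarith [(hξ p).2]⟩
  · refine ⟨⟨0, ⟨0, fun p => ⟨by simp [S.δ_nonneg p], by simp [S.δ_nonneg p]⟩, ?_⟩, ?_⟩, 0,
      fun p => ⟨by simp [S.δ_nonneg p], by simp [S.δ_nonneg p]⟩, ?_⟩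
    · ext i
      rcases i with i | i | i | i <;> simp [mkZ]
    · rw [add_zero]; rfl
    · rw [add_zero]; rfl

/-- Maximal solutions are complete; the velocities along a solution are bounded because `z` is. -/
theorem isComplete_of_isMaximalSolution [Nonempty (ZIdx N)] (hN : 0 < N)
    (hM : ∀ τ ∈ timerBox S, (-MMat S V D Λ τ).PosDef)
    (hφ : HybridSignal.IsMaximalSolution (closedLoop S V D) φ) : φ.IsComplete := by
  obtain ⟨α, κ₁, κ₂, hα, hκ₁, hκ₂, hz⟩ := exists_norm_zPart_le hN hM hφ.1
  set A := toEuclideanCLM (𝕜 := ℝ) (flowMatrix S V D) with hA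
  set R := ‖A‖ * (κ₁ + κ₂) + deltaMax S V with hR
  have hK0 : 0 ≤ R + ∑ p, (S.b p + S.δ p) := by
    have h1 : 0 ≤ ∑ p, (S.b p + S.δ p) := Finset.sum_nonneg fun p _ => by
      linarith [S.δ_nonneg p, S.δ_lt_b p]
    have := deltaMax_nonneg S V
    positivity
  refine hφ.isComplete (isClosed_flowSet S) (jumpSet_subset_flowSet S)
    (fun ξ _ => jumpMap_subset_flowSet ξ) ?_
    (fun t j h hD s hs => flow_ends_of_mem_jumpSet hφ.1 h hD hs)
    (fun ξ hξ hD => exists_flow_of_notMem_jumpSet hξ hD) (K := ⟨_, hK0⟩) ?_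
  · intro ξ hξ
    obtain ⟨p, hp⟩ := mem_iUnion.1 hξ
    refine ⟨WithLp.toLp 2 (Sum.elim (Sum.elim (eta ξ) (Sum.elim (Function.update (vtilde ξ) p 0)
      (Sum.elim (atilde ξ) (thtilde ξ)))) (Function.update (tau ξ) p (S.T₁ p))), p, hp,
      rfl, rfl, rfl, rfl, ?_, fun q hq => ?_⟩
    · simp only [tau, Sum.elim_inr, Function.update_self]
      exact ⟨le_rfl, S.T₁_le_T₂ p⟩
    · simp only [tau, Sum.elim_inr, Function.update_of_ne hq]
  · intro t j h v hv
    obtain ⟨⟨w, hw, hzv⟩, -⟩ := id hv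
    have ht0 := hφ.1.isArc.isDomain.1 _ h
    have h1 : ‖zPart (φ.val t j)‖ ≤ κ₁ + κ₂ := by
      have h2 : Real.exp (-α * (t + j)) ≤ 1 := by
        rw [Real.exp_le_one_iff]
        have : (0 : ℝ) ≤ t + j := add_nonneg ht0 (Nat.cast_nonneg j)
        nlinarith
      nlinarith [hz t j h]
    have h2 : ‖zPart v‖ ≤ R := by
      have h3 : zPart v = A (zPart (φ.val t j)) + w := hzv
      rw [h3]
      refine (norm_add_le _ _).trans (add_le_add ?_ (norm_le_deltaMax hw))
      exact (A.le_opNorm _).trans (mul_le_mul_of_nonneg_left h1 (norm_nonneg _))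
    have h3 : ∀ p, |tau v p| ≤ S.b p + S.δ p := fun p => by
      have := tau_of_mem_flowMap hv p
      rw [abs_le]
      exact ⟨this.1, by linarith [S.δ_nonneg p, S.δ_lt_b p]⟩
    have h4 : ∑ p, tau v p ^ 2 ≤ (∑ p, (S.b p + S.δ p)) ^ 2 := by
      refine le_trans ?_ (pow_le_pow_left₀ (Finset.sum_nonneg fun p _ => abs_nonneg (tau v p))
        (Finset.sum_le_sum fun p _ => h3 p) 2)
      simp only [← sq_abs (tau v _)]
      exact Finset.sum_sq_le_sq_sum_of_nonneg fun p _ => abs_nonneg _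
    have h5 := norm_sq_eq_zPart_add_tau v
    have h6 : 0 ≤ ∑ p, (S.b p + S.δ p) := (Finset.sum_nonneg fun p _ => abs_nonneg (tau v p)).trans
      (Finset.sum_le_sum fun p _ => h3 p)
    change ‖v‖ ≤ R + ∑ p, (S.b p + S.δ p)
    refine le_of_sq_le_sq ?_ hK0
    have h7 : ‖zPart v‖ ^ 2 ≤ R ^ 2 := pow_le_pow_left₀ (norm_nonneg _) h2 2
    nlinarith [mul_nonneg ((norm_nonneg _).trans h2) h6]

/-! ### Synchronization and boundedness of the inputs -/

/-- Software clocks differ by at most `√2 ‖z‖`. -/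
theorem abs_clock_sub_le (hN : 2 ≤ N) (hVD : IsLaplacianEigenbasis S V D) {ξ : State N}
    {ϑ : Fin N → ℝ} (h : eta ξ = Vᵀ *ᵥ ϑ) (p q : Fin N) : |ϑ p - ϑ q| ≤ √2 * ‖zPart ξ‖ := by
  refine (hVD.abs_sub_le hN ϑ p q).trans (mul_le_mul_of_nonneg_left ?_ (Real.sqrt_nonneg _))
  refine Real.sqrt_le_iff.2 ⟨norm_nonneg _, ?_⟩
  rw [← h, EuclideanSpace.real_norm_sq_eq, Fintype.sum_sum_type]
  have h1 : eta ξ ⬝ᵥ eta ξ = ∑ i, (zPart ξ).ofLp (Sum.inl i) ^ 2 := by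
    simp [dotProduct, eta, zPart, sq]
  rw [h1]
  exact le_add_of_nonneg_right (Finset.sum_nonneg fun _ _ => sq_nonneg _)

theorem syncFrom_of_norm_zPart_le (hN : 2 ≤ N) (hVD : IsLaplacianEigenbasis S V D) {ν T : ℝ}
    (h : ∀ t j, (t, j) ∈ φ.dom → T ≤ t + j → ‖zPart (φ.val t j)‖ ≤ ν / √2) :
    SyncFrom S V φ ν T := by
  intro ϑ hϑ t j htj hT p q _
  refine (abs_clock_sub_le hN hVD (hϑ t j htj) p q).trans ?_
  have h2 : (0 : ℝ) < √2 := by positivity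
  have := (le_div_iff₀ h2).1 (h t j htj hT)
  linarith

theorem abs_apply_le_norm_zPart (ξ : State N) (i : ZIdx N) : |ξ (Sum.inl i)| ≤ ‖zPart ξ‖ :=
  PiLp.norm_apply_le (zPart ξ) i

theorem abs_controlInput_le (hN : 2 ≤ N) (hVD : IsLaplacianEigenbasis S V D) {ξ : State N}
    {ϑ : Fin N → ℝ} (h : eta ξ = Vᵀ *ᵥ ϑ) {R : ℝ} (hR : ‖zPart ξ‖ ≤ R) (p : Fin N) :
    |controlInput S ξ ϑ p| ≤
      |S.aStar| + (∑ q, |S.a q| + R) + S.ku * (N * (√2 * R + 2 * R)) := by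
  classical
  have hR0 : 0 ≤ R := (norm_nonneg _).trans hR
  have h1 : |S.a p| ≤ ∑ q, |S.a q| :=
    Finset.single_le_sum (f := fun q => |S.a q|) (fun q _ => abs_nonneg _) (Finset.mem_univ p)
  have h2 : |atilde ξ p| ≤ R := (abs_apply_le_norm_zPart ξ _).trans hR
  have h3 : ∀ q, |vtilde ξ q| ≤ R := fun q => (abs_apply_le_norm_zPart ξ _).trans hR
  have h4 : ∀ q, |(ϑ q - vtilde ξ q) - (ϑ p - vtilde ξ p)| ≤ √2 * R + 2 * R := by
    intro q
    have e1 := (abs_clock_sub_le hN hVD h q p).trans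
      (mul_le_mul_of_nonneg_left hR (Real.sqrt_nonneg 2))
    have e2 := h3 q
    have e3 := h3 p
    rw [abs_le] at e1 e2 e3 ⊢
    constructor <;> linarith [e1.1, e1.2, e2.1, e2.2, e3.1, e3.2]
  rw [controlInput]
  refine (abs_add_le _ _).trans (add_le_add ?_ ?_)
  · refine (abs_sub _ _).trans (add_le_add le_rfl ((abs_sub _ _).trans (add_le_add h1 h2)))
  · rw [abs_mul, abs_of_pos S.ku_pos]
    refine mul_le_mul_of_nonneg_left ?_ S.ku_pos.le
    refine (Finset.abs_sum_le_sum_abs _ _).trans ((Finset.sum_le_sum fun q _ => h4 q).trans ?_)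
    rw [Finset.sum_const, nsmul_eq_mul]
    refine mul_le_mul_of_nonneg_right ?_ (by positivity)
    exact_mod_cast (Finset.card_le_univ _).trans_eq (Fintype.card_fin N)

/-- An exponentially decaying bound with `x = κ₁ r` falls below the level `l` at the time
`(1 / α) log (x / (l - c))`. -/
theorem mul_exp_add_le_of_log_le {α x c l s : ℝ} (hα : 0 < α) (hx : 0 < x) (hcl : c < l)
    (hs : 1 / α * Real.log (x / (l - c)) ≤ s) : x * Real.exp (-α * s) + c ≤ l := by
  have hlc : 0 < l - c := sub_pos.2 hcl
  have h1 : Real.log (x / (l - c)) ≤ α * s := by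
    rw [one_div, inv_mul_le_iff₀ hα] at hs
    exact hs
  have h2 : x / (l - c) ≤ Real.exp (α * s) := (Real.log_le_iff_le_exp (by positivity)).1 h1
  rw [div_le_iff₀ hlc] at h2
  have h3 : Real.exp (-α * s) * Real.exp (α * s) = 1 := by
    rw [← Real.exp_add]; simp
  have h4 := mul_le_mul_of_nonneg_left h2 (Real.exp_pos (-α * s)).le
  rw [← mul_assoc, h3, one_mul] at h4
  linarith

end ChronoSync

theorem theorem1 (N : ℕ) (hN : 2 ≤ N) (S : Network N)
    (V : Matrix (Fin N) (Fin (N - 1)) ℝ) (D : Matrix (Fin (N - 1)) (Fin (N - 1)) ℝ)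
    (hVD : IsLaplacianEigenbasis S V D) (Λ : LyapunovData N)
    (hM : ∀ τ ∈ timerBox S, (-MMat S V D Λ τ).PosDef) :
    -- the attractor is globally practically exponentially stable
    IsGPES (closedLoop S V D) (attractor S) ∧
    0 < mu S V D Λ ∧
    -- explicit constants
    (∀ ε κ h : ℝ, ε ∈ Set.Ioo 0 1 → κ ∈ Set.Ioo 0 (mu S V D Λ / specNorm (PMat Λ S.T₂)) →
      h ∈ Set.Ioc 0 (TMin S / bMax S) →
      (0 < muBar S V D Λ κ ∧ 0 < kappa1 S V D Λ κ ε h ∧ 0 ≤ kappa2 S V D Λ κ ∧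
        ((∃ p, 0 < S.δ p) → 0 < kappa2 S V D Λ κ) ∧ 0 < rate S V D Λ κ ε h) ∧
      -- exponential bound along every maximal solution
      (∀ φ, HybridSignal.IsMaximalSolution (closedLoop S V D) φ →
        ∀ t j, (t, j) ∈ φ.dom →
          Metric.infDist (φ.val t j) (attractor S) ≤
            kappa1 S V D Λ κ ε h * Real.exp (-rate S V D Λ κ ε h * (t + j)) *
              Metric.infDist (φ.val 0 0) (attractor S) + kappa2 S V D Λ κ) ∧
      -- approximate synchronization, with the explicit time
      (∀ ν : ℝ, kappa2 S V D Λ κ < ν / √2 →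
        AchievesApproxSync S V D ν ∧
        ∀ φ, HybridSignal.IsMaximalSolution (closedLoop S V D) φ →
          ν / √2 < kappa1 S V D Λ κ ε h * Metric.infDist (φ.val 0 0) (attractor S)
            + kappa2 S V D Λ κ →
          0 ≤ syncTime S V D Λ κ ε h ν (Metric.infDist (φ.val 0 0) (attractor S)) ∧
          SyncFrom S V φ ν
            (syncTime S V D Λ κ ε h ν (Metric.infDist (φ.val 0 0) (attractor S))))) ∧
    -- the control inputs are bounded along every maximal solution
    (∀ φ, HybridSignal.IsMaximalSolution (closedLoop S V D) φ →
      ∃ B : ℝ, ∀ ϑ, IsSoftwareClock V φ ϑ → ∀ t j, (t, j) ∈ φ.dom →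
        ∀ p, |controlInput S (φ.val t j) (ϑ t j) p| ≤ B) := by
  have hN0 : 0 < N := by omega
  have : Nonempty (ZIdx N) := ⟨Sum.inr (Sum.inl ⟨0, hN0⟩)⟩
  refine ⟨⟨isClosed_attractor S, fun ξ hξ => Or.inl hξ.1, fun φ hφ =>
    ⟨isComplete_of_isMaximalSolution hN0 hM hφ, ?_⟩⟩,
    (mu_pos_and_dotProduct_MMat_mulVec_le hM).1, ?_, ?_⟩
  · obtain ⟨α, κ₁, κ₂, hα, hκ₁, hκ₂, hz⟩ := exists_norm_zPart_le hN0 hM hφ.1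
    refine ⟨α, κ₁, κ₂, hα, hκ₁, hκ₂, fun t j h => ?_⟩
    rw [infDist_attractor (mem_flowSet_of_isSolution hφ.1 h)]
    exact hz t j h
  · intro ε κ h hε hκ hh
    have hμ := muBar_pos hκ
    have hκ₁ : 0 < kappa1 S V D Λ κ ε h := kappa1_pos κ ε h
    have hκ₂ : 0 ≤ kappa2 S V D Λ κ := kappa2_nonneg κ
    have hα := rate_pos hN0 hμ hε hh.1
    have hbound : ∀ φ, HybridSignal.IsMaximalSolution (closedLoop S V D) φ → ∀ t j,
        (t, j) ∈ φ.dom → ‖zPart (φ.val t j)‖ ≤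
          kappa1 S V D Λ κ ε h * Real.exp (-rate S V D Λ κ ε h * (t + j)) *
            ‖zPart (φ.val 0 0)‖ + kappa2 S V D Λ κ := fun φ hφ t j htj =>
      norm_zPart_le_exp hN0 hM hκ.1 hμ hε hh hφ.1 htj
    have hdist : ∀ φ, HybridSignal.IsMaximalSolution (closedLoop S V D) φ → ∀ t j,
        (t, j) ∈ φ.dom → Metric.infDist (φ.val t j) (attractor S) = ‖zPart (φ.val t j)‖ :=
      fun φ hφ t j htj => infDist_attractor (mem_flowSet_of_isSolution hφ.1 htj)
    refine ⟨⟨hμ, hκ₁, hκ₂, fun hδ => kappa2_pos hκ.1 hμ hδ, hα⟩, fun φ hφ t j htj => ?_,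
      fun ν hν => ?_⟩
    · rw [hdist φ hφ t j htj, hdist φ hφ 0 0 hφ.1.isArc.zero_mem]
      exact hbound φ hφ t j htj
    · have h2 : (0 : ℝ) < √2 := by positivity
      have main : ∀ φ, HybridSignal.IsMaximalSolution (closedLoop S V D) φ →
          ν / √2 < kappa1 S V D Λ κ ε h * Metric.infDist (φ.val 0 0) (attractor S)
            + kappa2 S V D Λ κ →
          0 ≤ syncTime S V D Λ κ ε h ν (Metric.infDist (φ.val 0 0) (attractor S)) ∧
          SyncFrom S V φ ν
            (syncTime S V D Λ κ ε h ν (Metric.infDist (φ.val 0 0) (attractor S))) := by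
        intro φ hφ hlt
        rw [hdist φ hφ 0 0 hφ.1.isArc.zero_mem] at hlt ⊢
        have hx : 0 < kappa1 S V D Λ κ ε h * ‖zPart (φ.val 0 0)‖ := by linarith
        have hT : syncTime S V D Λ κ ε h ν ‖zPart (φ.val 0 0)‖ = 1 / rate S V D Λ κ ε h *
            Real.log (kappa1 S V D Λ κ ε h * ‖zPart (φ.val 0 0)‖ /
              (ν / √2 - kappa2 S V D Λ κ)) := by
          have e : √2 * kappa1 S V D Λ κ ε h * ‖zPart (φ.val 0 0)‖ /
              (ν - √2 * kappa2 S V D Λ κ) = kappa1 S V D Λ κ ε h * ‖zPart (φ.val 0 0)‖ /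
              (ν / √2 - kappa2 S V D Λ κ) := by
            rw [← mul_div_mul_left _ (ν / √2 - kappa2 S V D Λ κ) h2.ne', mul_sub,
              mul_div_cancel₀ _ h2.ne', mul_assoc]
          rw [syncTime, e]
        rw [hT]
        refine ⟨mul_nonneg (by positivity) (Real.log_nonneg ?_),
          syncFrom_of_norm_zPart_le hN hVD fun t j htj hTt => ?_⟩
        · rw [one_le_div (by linarith)]
          linarith
        · refine (hbound φ hφ t j htj).trans ?_
          rw [mul_right_comm]
          exact mul_exp_add_le_of_log_le hα hx hν hTt
      refine ⟨fun φ hφ => ?_, main⟩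
      by_cases hlt : ν / √2 < kappa1 S V D Λ κ ε h *
          Metric.infDist (φ.val 0 0) (attractor S) + kappa2 S V D Λ κ
      · exact ⟨_, main φ hφ hlt⟩
      · -- the bound lies below the level `ν / √2` from the start
        refine ⟨0, le_rfl, syncFrom_of_norm_zPart_le hN hVD fun t j htj hTt => ?_⟩
        rw [hdist φ hφ 0 0 hφ.1.isArc.zero_mem] at hlt
        have h3 : Real.exp (-rate S V D Λ κ ε h * (t + j)) ≤ 1 := by
          rw [Real.exp_le_one_iff]
          nlinarith
        have h4 := mul_le_mul_of_nonneg_left h3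
          (mul_nonneg hκ₁.le (norm_nonneg (zPart (φ.val 0 0))))
        have h5 := hbound φ hφ t j htj
        rw [mul_right_comm] at h5
        linarith
  · intro φ hφ
    obtain ⟨α, κ₁, κ₂, hα, hκ₁, hκ₂, hz⟩ := exists_norm_zPart_le hN0 hM hφ.1
    refine ⟨_, fun ϑ hϑ t j htj p =>
      abs_controlInput_le hN hVD (hϑ t j htj) (R := κ₁ + κ₂) ?_ p⟩
    have h1 : Real.exp (-α * (t + j)) ≤ 1 := by
      rw [Real.exp_le_one_iff]
      have h0 := hφ.1.isArc.isDomain.1 _ htj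
      have : (0 : ℝ) ≤ t + j := add_nonneg h0 (Nat.cast_nonneg j)
      nlinarith
    nlinarith [hz t j htj]
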